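/- \textbf{Conventions.} All graphs are finite, simple and undirected, and paths repeat no vertex. A perfect matching (PM) of $G$ is a set $M\subseteq E(G)$ of edges touching every vertex exactly once. A path of $G$ is $M$-alternating if of any two consecutive edges exactly one lies in $M$. For a colouring $c:E(G)\to\{\text{red},\text{blue}\}$ and a set $F\subseteq E(G)$, let $r(F)$ and $b(F)$ be the numbers of red and blue edges in $F$; for PMs $M_1,M_2$ put $\operatorname{dist}(M_1,M_2)=\min\{r(M_1\triangle M_2),\,b(M_1\triangle M_2)\}$. For an integer $t\ge 2$, the graph $G$ has the property $\mathrm{Pshort}(t)$ if for every PM $M$ of $G$, every $M$-alternating path $P$ and every set $F=\{\{a_1,b_1\},\dots,\{a_t,b_t\}\}\subseteq P\cap M$ of $t$ distinct edges such that $a_1,b_1,a_2,b_2,\dots,a_t,b_t$ appear in this order along $P$, the graph $G$ contains an edge $\{a_i,b_j\}$ for some $1\le i<j\le t$, or both edges $\{a_{i_1},a_{i_3}\}$ and $\{b_{i_2},b_{i_4}\}$ for some $1\le i_1<i_2<i_3<i_4\le t$. \textbf{Locality lemma.} There is an absolute constant $C$ such that the following holds for every integer $t\ge2$, every graph $G$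 with the property $\mathrm{Pshort}(t)$, every colouring $c:E(G)\to\{\text{red},\text{blue}\}$ and all perfect matchings $M_1,M_2$ of $G$: \begin{enumerate} \item If $|r(M_1)-r(M_2)|>8t^2$, then there is a PM $\tilde M$ of $G$ with $\min\{r(M_1),r(M_2)\}<r(\tilde M)<\max\{r(M_1),r(M_2)\}$. \item If $|r(M_1)-r(M_2)|\le 8t^2$, then there is a PM $M_2'$ of $G$ with $r(M_2')=r(M_2)$ and $\operatorname{dist}(M_1,M_2')\le C\,t^{12}$. \end{enumerate} -/

import Mathlib

namespace ExactMatching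

variable {V : Type*} {G : SimpleGraph V}

/-- The two possible colours of an edge. -/
inductive EdgeColor where
  | red
  | blue

/-- The number of edges of colour `col` in a set `F` of edges of `G`. -/
noncomputable def colorCount (c : G.edgeSet → EdgeColor) (col : EdgeColor)
    (F : Set (Sym2 V)) : ℕ :=
  {e : G.edgeSet | (e : Sym2 V) ∈ F ∧ c e = col}.ncard

/-- `r(M)`: the number of red edges of the matching `M`. -/
noncomputable def redCount (c : G.edgeSet → EdgeColor) (M : G.Subgraph) : ℕ :=
  colorCount c EdgeColor.red M.edgeSet

/-- The distance of two perfect matchings: the smaller one of the numbers of red edges and of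
blue edges in their symmetric difference. -/
noncomputable def pmDist (c : G.edgeSet → EdgeColor) (M₁ M₂ : G.Subgraph) : ℕ :=
  min (colorCount c EdgeColor.red (symmDiff M₁.edgeSet M₂.edgeSet))
    (colorCount c EdgeColor.blue (symmDiff M₁.edgeSet M₂.edgeSet))

/-- `p` is an `M`-alternating path: no vertex is repeated, and of any two consecutive edges
exactly one belongs to `M`. -/
def IsAlternatingPath (M : G.Subgraph) {u v : V} (p : G.Walk u v) : Prop :=
  p.IsPath ∧ p.edges.IsChain fun e f => (e ∈ M.edgeSet ↔ f ∉ M.edgeSet)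

/-- The path-shortening property. For every perfect matching `M` and every `M`-alternating
path `p`, any `t` matching edges of `p`, taken in the order in which they occur on `p` (the
`i`-th one leads from the vertex `a i`, at position `k i` of `p`, to the next vertex `b i`),
can be short-cut: `G` has an edge `a i — b j` with `i < j`, or two edges `a i₁ — a i₃` and
`b i₂ — b i₄` with `i₁ < i₂ < i₃ < i₄`. -/
def Pshort (G : SimpleGraph V) (t : ℕ) : Prop :=
  ∀ M : G.Subgraph, M.IsPerfectMatching →
    ∀ (u v : V) (p : G.Walk u v), IsAlternatingPath M p →
      ∀ (k : Fin t → ℕ) (a b : Fin t → V), StrictMono k →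
        (∀ i, k i < p.length ∧ a i = p.getVert (k i) ∧ b i = p.getVert (k i + 1) ∧
          s(a i, b i) ∈ M.edgeSet) →
        (∃ i j, i < j ∧ G.Adj (a i) (b j)) ∨
        (∃ i₁ i₂ i₃ i₄, i₁ < i₂ ∧ i₂ < i₃ ∧ i₃ < i₄ ∧
          G.Adj (a i₁) (a i₃) ∧ G.Adj (b i₂) (b i₄))

end ExactMatching

/-! The symmetric difference of the two matchings is a union of alternating cycles. Replace $M_2$ by
a matching closest to $M_1$ among those that meet a constraint on the number of red edges; every
local exchange that brings it closer to $M_1$ must then violate the constraint.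

Cut the cycles into blocks that contain $O(t^2)$ blue edges each. Let a block have weight (red edges
of $M_2$) − (red edges of $M_1$). A block of weight at most 0 is good: it admits an exchange that
moves $M_2$ closer to $M_1$ and gains between 0 and $4t^2$ red edges. A short cycle is simply
swapped. On a path with at least $4t^2$ blue edges, follow the partial weights: they provide $t$
blue edges of $M_2$ at non-increasing heights that differ by at most $t$. `Pshort` joins some of
these by one chord or by two crossing chords, and rerouting along them changes the red count by a
difference of heights plus the chords (`exists_antitone_positions`,
`IsAlternatingSeq.exists_hasExchange`, `exists_blocks`).

Blocks that are not good have weight at least 1, so the total weight bounds the blue edges in terms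
of the number of good blocks (`sum_zeros_le`). For (1), the total weight is negative, so a good
block exists; by minimality its exchange lands strictly between the two red counts. For (2), if red
and blue edges were both numerous, there would be many good blocks for either colour. Disjoint ones
can be selected (`exists_disjoint_blocks`), and some of their exchanges cancel exactly
(`exists_zero_sum`), which contradicts minimality. -/

namespace ExactMatching

/-! ### Integer walks with bounded steps, and zero sums -/

open Finset

/-- A walk on `ℤ` that falls by at least `t` passes through `t` downward steps, one from each
level. -/
theorem exists_descending_positions {t i₀ j₀ : ℕ} {p q h : ℕ → ℤ}
    (hp : ∀ k, p k = 0 ∨ p k = 1) (hq : ∀ k, q k = 0 ∨ q k = 1)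
    (hs : ∀ k, h (k + 1) = h k + p k - q k) (hij : i₀ ≤ j₀) (hdrop : h j₀ + t ≤ h i₀) :
    ∃ k : Fin t → ℕ, StrictMono k ∧ (∀ i, k i < j₀) ∧ (∀ i, p (k i) = 0) ∧
      ∀ i, h (k i) = h i₀ - (i : ℕ) := by
  classical
  -- Take the last time at which the walk is at or above the level. The next step leaves it
  -- downwards, and steps have size at most 1, so the height there is exactly the level. Last times
  -- increase as the level decreases.
  have key : ∀ s : Fin t, ∃ g, g < j₀ ∧ p g = 0 ∧ h g = h i₀ - (s : ℕ) ∧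
      ∀ m, m ≤ j₀ → h i₀ - (s : ℕ) ≤ h m → m ≤ g := by
    intro s
    have hst : ((s : ℕ) : ℤ) + 1 ≤ t := by exact_mod_cast s.2
    let P : ℕ → Prop := fun m => h i₀ - (s : ℕ) ≤ h m
    have hPi : P i₀ := by simp only [P]; omega
    have hPg : P (Nat.findGreatest P j₀) := Nat.findGreatest_spec hij hPi
    have hle : Nat.findGreatest P j₀ ≤ j₀ := Nat.findGreatest_le _
    have hne : Nat.findGreatest P j₀ ≠ j₀ := by
      intro h1
      rw [h1] at hPg
      simp only [P] at hPg
      omega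
    have hlt : Nat.findGreatest P j₀ < j₀ := by omega
    have hnot : ¬ P (Nat.findGreatest P j₀ + 1) := by
      intro h1
      have := Nat.le_findGreatest (P := P) (n := j₀) (by omega) h1
      omega
    refine ⟨Nat.findGreatest P j₀, hlt, ?_, ?_, fun m hm hPm => Nat.le_findGreatest hm hPm⟩
    all_goals
      have h1 := hs (Nat.findGreatest P j₀)
      have h2 := hp (Nat.findGreatest P j₀)
      have h3 := hq (Nat.findGreatest P j₀)
      simp only [P] at hnot hPg h1 h2 h3 ⊢
      omega
  choose g hg1 hg2 hg3 hg4 using key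
  refine ⟨g, fun s s' hss => ?_, hg1, hg2, hg3⟩
  have hss' : (s : ℕ) < s' := hss
  have h1 := hg4 s' (g s) (hg1 s).le (by rw [hg3 s]; omega)
  have h2 : g s ≠ g s' := by
    intro h3
    have h4 := hg3 s
    rw [h3, hg3 s'] at h4
    omega
  omega

/-- Either the walk drops by `t` somewhere, and there is one position per level, or it stays
strictly between `-t` and `t`. As `h n ≤ 0`, at least half of the zeros belong to `p`, so $2t^2$
positions share fewer than $2t$ heights and `t` of them have the same height. -/
theorem exists_antitone_positions {t n : ℕ} {p q h : ℕ → ℤ}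
    (hp : ∀ k, p k = 0 ∨ p k = 1) (hq : ∀ k, q k = 0 ∨ q k = 1)
    (hs : ∀ k, h (k + 1) = h k + p k - q k) (h0 : h 0 = 0) (hn : h n ≤ 0) (ht : 1 ≤ t)
    (hblue : 4 * (t : ℤ) ^ 2 ≤ ∑ k ∈ range n, ((1 - p k) + (1 - q k))) :
    ∃ k : Fin t → ℕ, StrictMono k ∧ (∀ i, k i < n) ∧ (∀ i, p (k i) = 0) ∧
      (∀ i j, i ≤ j → h (k j) ≤ h (k i)) ∧ ∀ i j, h (k i) - h (k j) ≤ t := by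
  classical
  by_cases hd : ∃ i j, i ≤ j ∧ j ≤ n ∧ h j + t ≤ h i
  · obtain ⟨i, j, hij, hjn, hd⟩ := hd
    obtain ⟨k, hk, hkj, hkp, hkh⟩ := exists_descending_positions hp hq hs hij hd
    refine ⟨k, hk, fun i => (hkj i).trans_le hjn, hkp, fun i j hij => ?_, fun i j => ?_⟩
    · have : (i : ℕ) ≤ j := hij
      rw [hkh, hkh]; omega
    · have := i.2
      have := j.2
      rw [hkh, hkh]; omega
  · push Not at hd
    have hsum : ∀ m, h m = ∑ k ∈ range m, (p k - q k) := by
      intro m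
      induction m with
      | zero => simp [h0]
      | succ m ih => rw [sum_range_succ, ← ih, hs]; ring
    have hcard : (#{k ∈ range n | p k = 0} : ℤ) = ∑ k ∈ range n, (1 - p k) := by
      rw [card_filter]
      push_cast
      refine sum_congr rfl fun k _ => ?_
      rcases hp k with h1 | h1 <;> simp [h1]
    have hbig : 2 * (t : ℤ) ^ 2 ≤ #{k ∈ range n | p k = 0} := by
      have h1 := hsum n
      rw [hcard]
      simp only [sum_add_distrib, sum_sub_distrib] at hblue h1 ⊢
      linarith
    have hmaps : ∀ k ∈ ({k ∈ range n | p k = 0} : Finset ℕ),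
        h k ∈ Finset.Ioo (-(t : ℤ)) t := by
      intro k hk
      simp only [mem_filter, mem_range] at hk
      have h1 := hd 0 k (by omega) hk.1.le
      have h2 := hd k n hk.1.le le_rfl
      rw [Finset.mem_Ioo]
      omega
    have hmul : #(Finset.Ioo (-(t : ℤ)) t) * t ≤ #{k ∈ range n | p k = 0} := by
      have : (#(Finset.Ioo (-(t : ℤ)) t) : ℤ) ≤ 2 * t := by
        rw [Int.card_Ioo]; omega
      zify
      nlinarith
    obtain ⟨y, -, hy⟩ := exists_le_card_fiber_of_mul_le_card_of_maps_to hmaps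
      ⟨0, by rw [Finset.mem_Ioo]; omega⟩ hmul
    obtain ⟨T, hT, hTc⟩ := exists_subset_card_eq hy
    have hmem : ∀ i, T.orderEmbOfFin hTc i < n ∧ p (T.orderEmbOfFin hTc i) = 0 ∧
        h (T.orderEmbOfFin hTc i) = y := by
      intro i
      have := hT (T.orderEmbOfFin_mem hTc i)
      simpa [and_assoc] using this
    refine ⟨T.orderEmbOfFin hTc, (T.orderEmbOfFin hTc).strictMono, fun i => (hmem i).1,
      fun i => (hmem i).2.1, fun i j _ => ?_, fun i j => ?_⟩
    · rw [(hmem i).2.2, (hmem j).2.2]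
    · rw [(hmem i).2.2, (hmem j).2.2]; simp

/-- Many positive and many negative integers of bounded size contain a sub-collection with
sum zero. -/
theorem exists_zero_sum {ι : Type*} {A B : Finset ι} {δ : ι → ℤ} {W : ℕ}
    (hW : 1 ≤ W) (hAB : Disjoint A B) (hA : ∀ i ∈ A, 1 ≤ δ i ∧ δ i ≤ W)
    (hB : ∀ i ∈ B, -(W : ℤ) ≤ δ i ∧ δ i ≤ -1) (hAc : W * W ≤ #A) (hBc : W * W ≤ #B) :
    ∃ T ⊆ A.disjUnion B hAB, T.Nonempty ∧ ∑ i ∈ T, δ i = 0 := by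
  classical
  have hne : (Finset.Icc (1 : ℤ) W).Nonempty := ⟨1, by rw [Finset.mem_Icc]; omega⟩
  have hcard : #(Finset.Icc (1 : ℤ) W) = W := by simp
  obtain ⟨a, ha, hac⟩ := exists_le_card_fiber_of_mul_le_card_of_maps_to
    (s := A) (t := Finset.Icc (1 : ℤ) W) (f := δ) (n := W)
    (fun i hi => Finset.mem_Icc.2 (hA i hi)) hne (by rwa [hcard])
  obtain ⟨b, hb, hbc⟩ := exists_le_card_fiber_of_mul_le_card_of_maps_to
    (s := B) (t := Finset.Icc (1 : ℤ) W) (f := fun i => - δ i) (n := W)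
    (fun i hi => Finset.mem_Icc.2 (by have := hB i hi; omega)) hne (by rwa [hcard])
  rw [Finset.mem_Icc] at ha hb
  -- Pigeonhole gives at least `W` indices of value `a` and `W` of value `-b`. Taking `b` of the
  -- former and `a` of the latter gives sum zero, and `a, b ≤ W` ensures that there are enough.
  obtain ⟨A', hA', hA'c⟩ := exists_subset_card_eq
    (show b.toNat ≤ #{i ∈ A | δ i = a} by omega)
  obtain ⟨B', hB', hB'c⟩ := exists_subset_card_eq
    (show a.toNat ≤ #{i ∈ B | - δ i = b} by omega)
  have hA'A : A' ⊆ A := hA'.trans (filter_subset _ _)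
  have hB'B : B' ⊆ B := hB'.trans (filter_subset _ _)
  have hd : Disjoint A' B' := disjoint_of_subset_left hA'A (disjoint_of_subset_right hB'B hAB)
  refine ⟨A' ∪ B', ?_, ?_, ?_⟩
  · rw [disjUnion_eq_union]; exact union_subset_union hA'A hB'B
  · have : A'.Nonempty := by rw [← card_pos]; omega
    exact this.mono subset_union_left
  · have h1 : ∑ i ∈ A', δ i = ∑ i ∈ A', a :=
      sum_congr rfl fun i hi => (mem_filter.1 (hA' hi)).2
    have h2 : ∑ i ∈ B', δ i = ∑ i ∈ B', -b :=
      sum_congr rfl fun i hi => by have := (mem_filter.1 (hB' hi)).2; omega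
    have h3 : ((b.toNat : ℕ) : ℤ) = b := by omega
    have h4 : ((a.toNat : ℕ) : ℤ) = a := by omega
    rw [sum_union hd, h1, h2, sum_const, sum_const, hA'c, hB'c, nsmul_eq_mul, nsmul_eq_mul,
      h3, h4]
    ring

end ExactMatching

/-! ### Matchings as involutions; vertex sums count every edge twice, whence the factors 2 -/

namespace ExactMatching

open Finset

variable {V : Type*} {G : SimpleGraph V}

/-- A perfect matching of `G`, given as the map that sends a vertex to its partner. -/
structure IsMatchingMap (G : SimpleGraph V) (μ : V → V) : Prop where
  invol : ∀ v, μ (μ v) = v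
  adj : ∀ v, G.Adj v (μ v)

/-- There is a perfect matching on the vertex set `S` of total weight `c` which differs from `μ`
at no more than `d` vertices. -/
def HasMatchingOn [DecidableEq V] (G : SimpleGraph V) (μ : V → V) (ρ : V → V → ℤ)
    (S : Finset V) (c : ℤ) (d : ℕ) : Prop :=
  ∃ ν : V → V, (∀ v ∈ S, ν v ∈ S ∧ ν (ν v) = v ∧ G.Adj v (ν v)) ∧
    ∑ v ∈ S, ρ v (ν v) = 2 * c ∧ #{v ∈ S | ν v ≠ μ v} ≤ d

/-- The matching `μ₂` can be changed inside `S` such that its weight changes by `δ` and such that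
it gets closer to `μ₁`. -/
def HasExchange [DecidableEq V] (G : SimpleGraph V) (μ₁ μ₂ : V → V) (ρ : V → V → ℤ)
    (S : Finset V) (δ : ℤ) : Prop :=
  ∃ ν : V → V, (∀ v ∈ S, ν v ∈ S ∧ ν (ν v) = v ∧ G.Adj v (ν v)) ∧ (∀ v ∈ S, μ₂ v ∈ S) ∧
    ∑ v ∈ S, ρ v (ν v) = ∑ v ∈ S, ρ v (μ₂ v) + 2 * δ ∧
    #{v ∈ S | ν v ≠ μ₁ v} < #{v ∈ S | μ₂ v ≠ μ₁ v}

theorem exists_glue (S : Finset V) (ν ν' : V → V) :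
    ∃ g : V → V, (∀ v ∈ S, g v = ν v) ∧ ∀ v, v ∉ S → g v = ν' v := by
  classical
  exact ⟨fun v => if v ∈ S then ν v else ν' v, fun v hv => if_pos hv, fun v hv => if_neg hv⟩

theorem pair_eq_image [DecidableEq V] (f : ℕ → V) (x y : ℕ) :
    ({f x, f y} : Finset V) = ({x, y} : Finset ℕ).image f := by
  rw [image_insert, image_singleton]

theorem disjoint_image_of_injOn [DecidableEq V] {f : ℕ → V} {s t : Finset ℕ} {u : Set ℕ}
    (hf : Set.InjOn f u) (hs : (s : Set ℕ) ⊆ u) (ht : (t : Set ℕ) ⊆ u) (hst : Disjoint s t) :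
    Disjoint (s.image f) (t.image f) := by
  rw [disjoint_left]
  intro v hv hv'
  obtain ⟨a, ha, rfl⟩ := mem_image.1 hv
  obtain ⟨b, hb, hab⟩ := mem_image.1 hv'
  rw [hf (ht hb) (hs ha) hab] at hb
  exact disjoint_left.1 hst ha hb

variable [DecidableEq V] {μ₁ μ₂ : V → V} {ρ : V → V → ℤ}

theorem HasMatchingOn.union {μ : V → V} {S T : Finset V} {c c' : ℤ} {d d' : ℕ}
    (hS : HasMatchingOn G μ ρ S c d) (hT : HasMatchingOn G μ ρ T c' d') (hST : Disjoint S T) :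
    HasMatchingOn G μ ρ (S ∪ T) (c + c') (d + d') := by
  obtain ⟨ν, h1, h2, h3⟩ := hS
  obtain ⟨ν', h1', h2', h3'⟩ := hT
  obtain ⟨g, eS, eG⟩ := exists_glue S ν ν'
  have eT : ∀ v ∈ T, g v = ν' v := fun v hv => eG v (disjoint_right.1 hST hv)
  refine ⟨g, fun v hv => ?_, ?_, ?_⟩
  · rcases mem_union.1 hv with hv | hv
    · obtain ⟨h4, h5, h6⟩ := h1 v hv
      rw [eS v hv, eS _ h4]
      exact ⟨mem_union_left _ h4, h5, h6⟩
    · obtain ⟨h4, h5, h6⟩ := h1' v hv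
      rw [eT v hv, eT _ h4]
      exact ⟨mem_union_right _ h4, h5, h6⟩
  · rw [sum_union hST, sum_congr rfl fun v hv => by rw [eS v hv], h2,
      sum_congr (s₁ := T) rfl fun v hv => by rw [eT v hv], h2']
    ring
  · rw [filter_union]
    refine (card_union_le _ _).trans (add_le_add ?_ ?_)
    · rwa [filter_congr fun v hv => by rw [eS v hv]]
    · rwa [filter_congr (s := T) fun v hv => by rw [eT v hv]]

theorem HasMatchingOn.pair (hρ : ∀ v w, ρ v w = ρ w v) (μ : V → V) {x y : V}
    (h : G.Adj x y) : HasMatchingOn G μ ρ {x, y} (ρ x y) 2 := by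
  refine ⟨fun v => if v = x then y else x, fun v hv => ?_, ?_, ?_⟩
  · have hxy := h.ne'
    simp only [mem_insert, mem_singleton] at hv
    rcases hv with rfl | rfl
    · simp [hxy, h]
    · simp [hxy, h.symm]
  · rw [sum_pair h.ne]
    simp only [if_true, if_neg h.ne']
    rw [hρ y x]; ring
  · exact (card_filter_le _ _).trans card_le_two

theorem HasExchange.union {S T : Finset V} {δ δ' : ℤ}
    (hS : HasExchange G μ₁ μ₂ ρ S δ) (hT : HasExchange G μ₁ μ₂ ρ T δ') (hST : Disjoint S T) :
    HasExchange G μ₁ μ₂ ρ (S ∪ T) (δ + δ') := by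
  obtain ⟨ν, h1, hc, h2, h3⟩ := hS
  obtain ⟨ν', h1', hc', h2', h3'⟩ := hT
  obtain ⟨g, eS, eG⟩ := exists_glue S ν ν'
  have eT : ∀ v ∈ T, g v = ν' v := fun v hv => eG v (disjoint_right.1 hST hv)
  refine ⟨g, fun v hv => ?_, fun v hv => ?_, ?_, ?_⟩
  · rcases mem_union.1 hv with hv | hv
    · obtain ⟨h4, h5, h6⟩ := h1 v hv
      rw [eS v hv, eS _ h4]
      exact ⟨mem_union_left _ h4, h5, h6⟩
    · obtain ⟨h4, h5, h6⟩ := h1' v hv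
      rw [eT v hv, eT _ h4]
      exact ⟨mem_union_right _ h4, h5, h6⟩
  · rcases mem_union.1 hv with hv | hv
    · exact mem_union_left _ (hc v hv)
    · exact mem_union_right _ (hc' v hv)
  · rw [sum_union hST, sum_union hST, sum_congr rfl fun v hv => by rw [eS v hv], h2,
      sum_congr (s₁ := T) rfl fun v hv => by rw [eT v hv], h2']
    ring
  · rw [filter_union, filter_union, card_union_of_disjoint (disjoint_filter_filter hST),
      card_union_of_disjoint (disjoint_filter_filter hST),
      filter_congr fun v hv => by rw [eS v hv],
      filter_congr (s := T) fun v hv => by rw [eT v hv]]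
    exact add_lt_add h3 h3'

theorem HasExchange.biUnion {ι : Type*} {T : Finset ι} (hT : T.Nonempty) {S : ι → Finset V}
    {δ : ι → ℤ} (h : ∀ i ∈ T, HasExchange G μ₁ μ₂ ρ (S i) (δ i))
    (hd : (T : Set ι).PairwiseDisjoint S) :
    HasExchange G μ₁ μ₂ ρ (T.biUnion S) (∑ i ∈ T, δ i) := by
  classical
  induction hT using Finset.Nonempty.cons_induction with
  | singleton a => simpa using h
  | cons a s ha hs ih =>
    rw [sum_cons, cons_eq_insert, biUnion_insert]
    refine (h a (mem_cons_self a s)).union (ih (fun i hi => h i (mem_cons_of_mem hi))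
      (hd.subset (by simp))) ?_
    rw [disjoint_biUnion_right]
    intro i hi
    exact hd (by simp) (by simp [hi]) (by rintro rfl; exact ha hi)

/-- Counting the edges of weight zero instead of those of weight one. -/
theorem HasExchange.compl {S : Finset V} {δ : ℤ}
    (h : HasExchange G μ₁ μ₂ (fun v w => 1 - ρ v w) S δ) : HasExchange G μ₁ μ₂ ρ S (-δ) := by
  obtain ⟨ν, h1, hc, h2, h3⟩ := h
  refine ⟨ν, h1, hc, ?_, h3⟩
  simp only [sum_sub_distrib] at h2
  linarith

theorem HasExchange.nonempty {S : Finset V} {δ : ℤ} (h : HasExchange G μ₁ μ₂ ρ S δ) :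
    S.Nonempty := by
  obtain ⟨ν, -, -, -, h3⟩ := h
  rw [nonempty_iff_ne_empty]
  rintro rfl
  simp at h3

theorem HasMatchingOn.hasExchange {S : Finset V} {c c' : ℤ} {d : ℕ}
    (h : HasMatchingOn G μ₁ ρ S c d) (hc : ∀ v ∈ S, μ₂ v ∈ S)
    (hc' : ∑ v ∈ S, ρ v (μ₂ v) = 2 * c') (hd : d < #{v ∈ S | μ₂ v ≠ μ₁ v}) :
    HasExchange G μ₁ μ₂ ρ S (c - c') := by
  obtain ⟨ν, h1, h2, h3⟩ := h
  exact ⟨ν, h1, hc, by rw [h2, hc']; ring, h3.trans_lt hd⟩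

theorem HasExchange.exists_isMatchingMap [Fintype V] {S : Finset V} {δ : ℤ}
    (hμ₂ : IsMatchingMap G μ₂) (h : HasExchange G μ₁ μ₂ ρ S δ) :
    ∃ ν, IsMatchingMap G ν ∧ ∑ v, ρ v (ν v) = ∑ v, ρ v (μ₂ v) + 2 * δ ∧
      #{v | ν v ≠ μ₁ v} < #{v | μ₂ v ≠ μ₁ v} := by
  obtain ⟨ν, h1, hc, h2, h3⟩ := h
  have hc' : ∀ v, v ∉ S → μ₂ v ∉ S := fun v hv hv' => hv (by simpa [hμ₂.invol] using hc _ hv')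
  obtain ⟨g, eS, eG⟩ := exists_glue S ν μ₂
  have eT : ∀ v ∈ Sᶜ, g v = μ₂ v := fun v hv => eG v (mem_compl.1 hv)
  have hd : Disjoint S Sᶜ := disjoint_compl_right
  refine ⟨g, ⟨fun v => ?_, fun v => ?_⟩, ?_, ?_⟩
  · by_cases hv : v ∈ S
    · obtain ⟨h4, h5, h6⟩ := h1 v hv
      rw [eS v hv, eS _ h4, h5]
    · rw [eG v hv, eG _ (hc' v hv), hμ₂.invol]
  · by_cases hv : v ∈ S
    · rw [eS v hv]
      exact (h1 v hv).2.2
    · rw [eG v hv]; exact hμ₂.adj v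
  · rw [← sum_add_sum_compl S, ← sum_add_sum_compl S (fun v => ρ v (μ₂ v)),
      sum_congr rfl fun v hv => by rw [eS v hv], h2,
      sum_congr (s₁ := Sᶜ) rfl fun v hv => by rw [eT v hv]]
    ring
  · rw [← union_compl S, filter_union, filter_union,
      card_union_of_disjoint (disjoint_filter_filter hd),
      card_union_of_disjoint (disjoint_filter_filter hd),
      filter_congr fun v hv => by rw [eS v hv],
      filter_congr (s := Sᶜ) fun v hv => by rw [eT v hv]]
    exact Nat.add_lt_add_right h3 _

/-! ### Alternating sequences and rerouting along chords -/

theorem sum_Ico_even {i j : ℕ} (hij : i ≤ j) (g : ℕ → ℤ) :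
    ∑ m ∈ Ico (2 * i) (2 * j), g m = ∑ k ∈ Ico i j, (g (2 * k) + g (2 * k + 1)) := by
  induction j, hij using Nat.le_induction with
  | base => simp
  | succ j hij ih =>
    rw [sum_Ico_succ_top hij, ← ih, show 2 * (j + 1) = 2 * j + 1 + 1 by ring,
      sum_Ico_succ_top (by omega), sum_Ico_succ_top (by omega)]
    ring

theorem sum_Ico_odd {i j : ℕ} (hij : i ≤ j) (g : ℕ → ℤ) :
    ∑ m ∈ Ico (2 * i + 1) (2 * j + 1), g m
      = ∑ k ∈ Ico i j, (g (2 * k + 1) + g (2 * k + 2)) := by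
  rw [← sum_Ico_add', sum_Ico_even hij]

/-- The sequence `f` follows alternately the edges of `μ₂` and of `μ₁`. -/
structure IsAlternatingSeq (μ₁ μ₂ : V → V) (f : ℕ → V) : Prop where
  even : ∀ k, μ₂ (f (2 * k)) = f (2 * k + 1)
  odd : ∀ k, μ₁ (f (2 * k + 1)) = f (2 * k + 2)

variable {f : ℕ → V}

theorem IsAlternatingSeq.hasMatchingOn_odd (hf : IsAlternatingSeq μ₁ μ₂ f)
    (hμ₁ : IsMatchingMap G μ₁) (hρ : ∀ v w, ρ v w = ρ w v) {i j : ℕ} (hij : i ≤ j)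
    (hinj : Set.InjOn f (Ico (2 * i + 1) (2 * j + 1) : Finset ℕ)) :
    HasMatchingOn G μ₁ ρ ((Ico (2 * i + 1) (2 * j + 1)).image f)
      (∑ k ∈ Ico i j, ρ (f (2 * k + 1)) (f (2 * k + 2))) 0 := by
  have hodd' : ∀ k, μ₁ (f (2 * k + 2)) = f (2 * k + 1) := fun k => by
    rw [← hf.odd k, hμ₁.invol]
  refine ⟨μ₁, fun v hv => ⟨?_, hμ₁.invol v, hμ₁.adj v⟩, ?_, by simp⟩
  · obtain ⟨m, hm, rfl⟩ := mem_image.1 hv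
    rw [mem_Ico] at hm
    rcases Nat.even_or_odd' m with ⟨k, rfl | rfl⟩
    · obtain ⟨k, rfl⟩ : ∃ l, k = l + 1 := ⟨k - 1, by omega⟩
      rw [show 2 * (k + 1) = 2 * k + 2 by ring, hodd']
      exact mem_image_of_mem _ (mem_Ico.2 (by omega))
    · rw [hf.odd]
      exact mem_image_of_mem _ (mem_Ico.2 (by omega))
  · rw [sum_image hinj, sum_Ico_odd hij, mul_sum]
    refine sum_congr rfl fun k _ => ?_
    rw [hf.odd, hodd', hρ (f (2 * k + 2))]
    ring

theorem IsAlternatingSeq.even_segment (hf : IsAlternatingSeq μ₁ μ₂ f)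
    (hμ₂ : IsMatchingMap G μ₂) (hρ : ∀ v w, ρ v w = ρ w v) {i j : ℕ} (hij : i ≤ j)
    (hinj : Set.InjOn f (Ico (2 * i) (2 * j) : Finset ℕ))
    (hne : ∀ m ∈ Ico (2 * i) (2 * j), μ₂ (f m) ≠ μ₁ (f m)) :
    (∀ v ∈ (Ico (2 * i) (2 * j)).image f, μ₂ v ∈ (Ico (2 * i) (2 * j)).image f) ∧
    ∑ v ∈ (Ico (2 * i) (2 * j)).image f, ρ v (μ₂ v)
      = 2 * ∑ k ∈ Ico i j, ρ (f (2 * k)) (f (2 * k + 1)) ∧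
    #{v ∈ (Ico (2 * i) (2 * j)).image f | μ₂ v ≠ μ₁ v} = 2 * (j - i) := by
  have heven' : ∀ k, μ₂ (f (2 * k + 1)) = f (2 * k) := fun k => by
    rw [← hf.even k, hμ₂.invol]
  refine ⟨fun v hv => ?_, ?_, ?_⟩
  · obtain ⟨m, hm, rfl⟩ := mem_image.1 hv
    rw [mem_Ico] at hm
    rcases Nat.even_or_odd' m with ⟨k, rfl | rfl⟩
    · rw [hf.even]
      exact mem_image_of_mem _ (mem_Ico.2 (by omega))
    · rw [heven']
      exact mem_image_of_mem _ (mem_Ico.2 (by omega))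
  · rw [sum_image hinj, sum_Ico_even hij, mul_sum]
    refine sum_congr rfl fun k _ => ?_
    rw [hf.even, heven', hρ (f (2 * k + 1))]
    ring
  · rw [filter_true_of_mem, card_image_of_injOn hinj, Nat.card_Ico]
    · omega
    · intro v hv
      obtain ⟨m, hm, rfl⟩ := mem_image.1 hv
      exact hne m hm

/-- The exchange along a chord that joins the beginning and the end of a segment. -/
theorem IsAlternatingSeq.hasExchange_chord (hf : IsAlternatingSeq μ₁ μ₂ f)
    (hμ₁ : IsMatchingMap G μ₁) (hμ₂ : IsMatchingMap G μ₂) (hρ : ∀ v w, ρ v w = ρ w v)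
    {n : ℕ} (hinj : Set.InjOn f (Set.Iio (2 * n))) (hne : ∀ m < 2 * n, μ₂ (f m) ≠ μ₁ (f m))
    {i j : ℕ} (hij : i < j) (hj : j < n) (hadj : G.Adj (f (2 * i)) (f (2 * j + 1))) :
    HasExchange G μ₁ μ₂ ρ ((Ico (2 * i) (2 * (j + 1))).image f)
      (ρ (f (2 * i)) (f (2 * j + 1)) + ∑ k ∈ Ico i j, ρ (f (2 * k + 1)) (f (2 * k + 2))
        - ∑ k ∈ Ico i (j + 1), ρ (f (2 * k)) (f (2 * k + 1))) := by
  have hsub : ∀ {s : Finset ℕ}, (∀ m ∈ s, m < 2 * n) → Set.InjOn f s :=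
    fun hs => hinj.mono fun m hm => hs m hm
  have e : (Ico (2 * i) (2 * (j + 1))).image f
      = {f (2 * i), f (2 * j + 1)} ∪ (Ico (2 * i + 1) (2 * j + 1)).image f := by
    rw [pair_eq_image f, ← image_union]
    congr 1
    ext m
    simp only [mem_Ico, mem_union, mem_insert, mem_singleton]
    omega
  obtain ⟨h1, h2, h3⟩ := hf.even_segment (i := i) (j := j + 1) hμ₂ hρ (by omega)
    (hsub fun m hm => by rw [mem_Ico] at hm; omega)
    (fun m hm => hne m (by rw [mem_Ico] at hm; omega))
  -- The new matching disagrees with `μ₁` at most at the two ends of the chord, whereas `μ₂` does so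
  -- on the whole segment, which has at least four vertices.
  refine HasMatchingOn.hasExchange (d := 2 + 0) ?_ h1 h2 (by rw [h3]; omega)
  rw [e]
  refine (HasMatchingOn.pair hρ μ₁ hadj).union (hf.hasMatchingOn_odd hμ₁ hρ hij.le
    (hsub fun m hm => by rw [mem_Ico] at hm; omega)) ?_
  rw [pair_eq_image f]
  refine disjoint_image_of_injOn hinj ?_ ?_ ?_
  · intro m hm
    simp only [coe_insert, coe_singleton, Set.mem_insert_iff, Set.mem_singleton_iff] at hm
    rw [Set.mem_Iio]; omega
  · intro m hm
    rw [mem_coe, mem_Ico] at hm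
    rw [Set.mem_Iio]; omega
  · rw [disjoint_left]
    intro m
    simp only [mem_Ico, mem_insert, mem_singleton]
    omega

/-- The exchange along two crossing chords. -/
theorem IsAlternatingSeq.hasExchange_crossing (hf : IsAlternatingSeq μ₁ μ₂ f)
    (hμ₁ : IsMatchingMap G μ₁) (hμ₂ : IsMatchingMap G μ₂) (hρ : ∀ v w, ρ v w = ρ w v)
    {n : ℕ} (hinj : Set.InjOn f (Set.Iio (2 * n))) (hne : ∀ m < 2 * n, μ₂ (f m) ≠ μ₁ (f m))
    {i₁ i₂ i₃ i₄ : ℕ} (h12 : i₁ < i₂) (h23 : i₂ < i₃) (h34 : i₃ < i₄) (h4 : i₄ < n)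
    (ha : G.Adj (f (2 * i₁)) (f (2 * i₃))) (hb : G.Adj (f (2 * i₂ + 1)) (f (2 * i₄ + 1))) :
    HasExchange G μ₁ μ₂ ρ
      ((Ico (2 * i₁) (2 * (i₂ + 1))).image f ∪ (Ico (2 * i₃) (2 * (i₄ + 1))).image f)
      ((ρ (f (2 * i₁)) (f (2 * i₃)) + ρ (f (2 * i₂ + 1)) (f (2 * i₄ + 1))
        + (∑ k ∈ Ico i₁ i₂, ρ (f (2 * k + 1)) (f (2 * k + 2))
          + ∑ k ∈ Ico i₃ i₄, ρ (f (2 * k + 1)) (f (2 * k + 2))))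
        - (∑ k ∈ Ico i₁ (i₂ + 1), ρ (f (2 * k)) (f (2 * k + 1))
          + ∑ k ∈ Ico i₃ (i₄ + 1), ρ (f (2 * k)) (f (2 * k + 1)))) := by
  have hsub : ∀ {s : Finset ℕ}, (∀ m ∈ s, m < 2 * n) → Set.InjOn f s :=
    fun hs => hinj.mono fun m hm => hs m hm
  have hdisj : ∀ {s t : Finset ℕ}, (∀ m ∈ s, m < 2 * n) → (∀ m ∈ t, m < 2 * n) →
      (∀ m ∈ s, m ∉ t) → Disjoint (s.image f) (t.image f) := fun hs ht hst =>
    disjoint_image_of_injOn hinj (fun m hm => hs m hm) (fun m hm => ht m hm)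
      (disjoint_left.2 hst)
  have e : (Ico (2 * i₁) (2 * (i₂ + 1))).image f ∪ (Ico (2 * i₃) (2 * (i₄ + 1))).image f
      = ({f (2 * i₁), f (2 * i₃)} ∪ {f (2 * i₂ + 1), f (2 * i₄ + 1)}) ∪
        ((Ico (2 * i₁ + 1) (2 * i₂ + 1)).image f ∪
          (Ico (2 * i₃ + 1) (2 * i₄ + 1)).image f) := by
    simp only [pair_eq_image f, ← image_union]
    congr 1
    ext m
    simp only [mem_Ico, mem_union, mem_insert, mem_singleton]
    omega
  obtain ⟨h1, h2, h3⟩ := hf.even_segment (i := i₁) (j := i₂ + 1) hμ₂ hρ (by omega)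
    (hsub fun m hm => by rw [mem_Ico] at hm; omega)
    (fun m hm => hne m (by rw [mem_Ico] at hm; omega))
  obtain ⟨h1', h2', h3'⟩ := hf.even_segment (i := i₃) (j := i₄ + 1) hμ₂ hρ (by omega)
    (hsub fun m hm => by rw [mem_Ico] at hm; omega)
    (fun m hm => hne m (by rw [mem_Ico] at hm; omega))
  have hd : Disjoint ((Ico (2 * i₁) (2 * (i₂ + 1))).image f)
      ((Ico (2 * i₃) (2 * (i₄ + 1))).image f) := by
    refine hdisj ?_ ?_ ?_ <;> intro m <;> simp only [mem_Ico] <;> omega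
  -- At most four chord ends disagree with `μ₁`, against at least eight vertices for `μ₂`. The
  -- stretch between the two segments keeps its `μ₂` edges.
  refine HasMatchingOn.hasExchange (d := 2 + 2 + (0 + 0)) ?_ ?_ ?_ ?_
  · rw [e]
    refine ((HasMatchingOn.pair hρ μ₁ ha).union (HasMatchingOn.pair hρ μ₁ hb) ?_).union
      ((hf.hasMatchingOn_odd hμ₁ hρ h12.le
        (hsub fun m hm => by rw [mem_Ico] at hm; omega)).union
      (hf.hasMatchingOn_odd hμ₁ hρ h34.le
        (hsub fun m hm => by rw [mem_Ico] at hm; omega)) ?_) ?_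
    all_goals
      try simp only [pair_eq_image f, ← image_union]
      refine hdisj ?_ ?_ ?_ <;> intro m <;>
        simp only [mem_Ico, mem_union, mem_insert, mem_singleton] <;> omega
  · intro v hv
    rcases mem_union.1 hv with hv | hv
    · exact mem_union_left _ (h1 v hv)
    · exact mem_union_right _ (h1' v hv)
  · rw [sum_union hd, h2, h2']; ring
  · rw [filter_union, card_union_of_disjoint (disjoint_filter_filter hd), h3, h3']
    omega

end ExactMatching

/-! ### From path shortening to exchanges on paths and cycles -/

namespace ExactMatching

open Finset

section Walk

variable {V : Type*} {G : SimpleGraph V}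

theorem exists_walk_of_seq {f : ℕ → V} {N : ℕ} (hadj : ∀ k < N, G.Adj (f k) (f (k + 1))) :
    ∃ p : G.Walk (f 0) (f N), p.length = N ∧ p.support = (List.range (N + 1)).map f ∧
      p.edges = (List.range N).map fun k => s(f k, f (k + 1)) := by
  induction N with
  | zero => exact ⟨.nil, by simp⟩
  | succ N ih =>
    obtain ⟨p, h1, h2, h3⟩ := ih fun k hk => hadj k (by omega)
    refine ⟨p.concat (hadj N (by omega)), by simp [h1], ?_, ?_⟩
    · rw [SimpleGraph.Walk.support_concat, h2, List.range_succ (n := N + 1), List.map_append]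
      simp
    · rw [SimpleGraph.Walk.edges_concat, h3, List.range_succ (n := N), List.map_append]
      simp

/-- The map of partners of a perfect matching. -/
theorem exists_isMatchingMap_of_isPerfectMatching {M : G.Subgraph}
    (hM : M.IsPerfectMatching) :
    ∃ μ, IsMatchingMap G μ ∧ ∀ v w, M.Adj v w ↔ μ v = w := by
  rw [SimpleGraph.Subgraph.isPerfectMatching_iff] at hM
  choose μ h1 h2 using hM
  have h3 : ∀ v w, M.Adj v w ↔ μ v = w :=
    fun v w => ⟨fun h => (h2 v w h).symm, fun h => h ▸ h1 v⟩
  exact ⟨μ, ⟨fun v => (h3 _ _).1 (h1 v).symm, fun v => (h1 v).adj_sub⟩, h3⟩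

theorem IsMatchingMap.exists_subgraph {μ : V → V} (hμ : IsMatchingMap G μ) :
    ∃ M : G.Subgraph, M.IsPerfectMatching ∧ ∀ v w, M.Adj v w ↔ μ v = w := by
  refine ⟨⟨Set.univ, fun v w => μ v = w, ?_, fun _ => Set.mem_univ _, ?_⟩, ?_,
    fun _ _ => Iff.rfl⟩
  · rintro v w rfl
    exact hμ.adj v
  · constructor
    rintro v w rfl
    exact hμ.invol v
  · rw [SimpleGraph.Subgraph.isPerfectMatching_iff]
    exact fun v => ⟨μ v, rfl, fun w h => Eq.symm h⟩

theorem IsAlternatingSeq.exists_chords {t n : ℕ} {μ₁ μ₂ : V → V} {f : ℕ → V} (hP : Pshort G t)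
    (hf : IsAlternatingSeq μ₁ μ₂ f) (hμ₁ : IsMatchingMap G μ₁) (hμ₂ : IsMatchingMap G μ₂)
    (hinj : Set.InjOn f (Set.Iio (2 * n))) (hne : ∀ m < 2 * n, μ₂ (f m) ≠ μ₁ (f m))
    (hn : 1 ≤ n) {k : Fin t → ℕ} (hk : StrictMono k) (hkn : ∀ i, k i < n) :
    (∃ i j, i < j ∧ G.Adj (f (2 * k i)) (f (2 * k j + 1))) ∨
      (∃ i₁ i₂ i₃ i₄, i₁ < i₂ ∧ i₂ < i₃ ∧ i₃ < i₄ ∧ G.Adj (f (2 * k i₁)) (f (2 * k i₃)) ∧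
        G.Adj (f (2 * k i₂ + 1)) (f (2 * k i₄ + 1))) := by
  obtain ⟨M, hM, hMμ⟩ := hμ₂.exists_subgraph
  have hstep : ∀ m, f (m + 1) = μ₂ (f m) ∧ Even m ∨ f (m + 1) = μ₁ (f m) ∧ ¬ Even m := by
    intro m
    rcases Nat.even_or_odd' m with ⟨l, rfl | rfl⟩
    · exact Or.inl ⟨(hf.even l).symm, even_two_mul l⟩
    · exact Or.inr ⟨(hf.odd l).symm, by simp⟩
  -- The path stops at `f (2 * n - 1)`: it contains all `n` edges of `μ₂`, but not `f (2 * n)`,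
  -- which may coincide with `f 0`.
  have hadj : ∀ m < 2 * n - 1, G.Adj (f m) (f (m + 1)) := by
    intro m _
    rcases hstep m with ⟨h, -⟩ | ⟨h, -⟩
    · rw [h]; exact hμ₂.adj _
    · rw [h]; exact hμ₁.adj _
  have hmem : ∀ m < 2 * n, s(f m, f (m + 1)) ∈ M.edgeSet ↔ Even m := by
    intro m hm
    rw [SimpleGraph.Subgraph.mem_edgeSet, hMμ]
    rcases hstep m with ⟨h, h'⟩ | ⟨h, h'⟩
    · simp [h, h']
    · simp [h, h', hne m hm]
  obtain ⟨p, hl, hs, he⟩ := exists_walk_of_seq hadj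
  have hget : ∀ m < 2 * n, p.getVert m = f m := by
    intro m hm
    rw [p.getVert_eq_support_getElem (by omega)]
    simp [hs]
  have halt : IsAlternatingPath M p := by
    constructor
    · rw [SimpleGraph.Walk.isPath_def, hs]
      refine List.Nodup.map_on ?_ List.nodup_range
      intro a ha b hb hab
      rw [List.mem_range] at ha hb
      exact hinj (by rw [Set.mem_Iio]; omega) (by rw [Set.mem_Iio]; omega) hab
    · rw [he, List.isChain_iff_getElem]
      intro m hm
      simp only [List.length_map, List.length_range] at hm
      simp only [List.getElem_map, List.getElem_range]
      rw [hmem m (by omega), hmem (m + 1) (by omega), Nat.even_add_one, not_not]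
  refine hP M hM _ _ p halt (fun i => 2 * k i) (fun i => f (2 * k i))
    (fun i => f (2 * k i + 1)) (fun i j hij => ?_) fun i => ?_
  · have := hk hij
    simp only
    omega
  · have := hkn i
    exact ⟨by omega, (hget _ (by omega)).symm, (hget _ (by omega)).symm,
      (hmem _ (by omega)).2 (even_two_mul _)⟩

end Walk

variable {V : Type*} {G : SimpleGraph V} [DecidableEq V] {μ₁ μ₂ : V → V} {ρ : V → V → ℤ}
  {f : ℕ → V}

/-- An alternating path with many edges of weight zero but without positive total weight can be
exchanged for a matching of slightly larger weight. -/
theorem IsAlternatingSeq.exists_hasExchange {t n : ℕ} (ht : 1 ≤ t) (hP : Pshort G t)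
    (hf : IsAlternatingSeq μ₁ μ₂ f) (hμ₁ : IsMatchingMap G μ₁) (hμ₂ : IsMatchingMap G μ₂)
    (hρ : ∀ v w, ρ v w = ρ w v) (hρ' : ∀ v w, ρ v w = 0 ∨ ρ v w = 1)
    (hinj : Set.InjOn f (Set.Iio (2 * n))) (hne : ∀ m < 2 * n, μ₂ (f m) ≠ μ₁ (f m))
    (hw : ∑ k ∈ range n, (ρ (f (2 * k)) (f (2 * k + 1)) - ρ (f (2 * k + 1)) (f (2 * k + 2)))
      ≤ 0)
    (hb : 4 * (t : ℤ) ^ 2 ≤ ∑ k ∈ range n, ((1 - ρ (f (2 * k)) (f (2 * k + 1)))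
      + (1 - ρ (f (2 * k + 1)) (f (2 * k + 2))))) :
    ∃ S ⊆ (range (2 * n)).image f, ∃ δ : ℤ, 0 ≤ δ ∧ δ ≤ t + 2 ∧ HasExchange G μ₁ μ₂ ρ S δ := by
  set p : ℕ → ℤ := fun k => ρ (f (2 * k)) (f (2 * k + 1)) with hp
  set q : ℕ → ℤ := fun k => ρ (f (2 * k + 1)) (f (2 * k + 2)) with hq
  set h : ℕ → ℤ := fun m => ∑ k ∈ range m, (p k - q k) with hh
  have hn : 1 ≤ n := by
    rcases Nat.eq_zero_or_pos n with rfl | h0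
    · simp only [range_zero, sum_empty] at hb
      have : (1 : ℤ) ≤ t := by exact_mod_cast ht
      nlinarith
    · exact h0
  obtain ⟨k, hk, hkn, hkp, hkanti, hkt⟩ := exists_antitone_positions (p := p) (q := q) (h := h)
    (fun k => hρ' _ _) (fun k => hρ' _ _)
    (fun k => by simp only [hh, sum_range_succ]; ring) (by simp [hh]) hw ht hb
  -- The removed segment has one more `μ₂` edge than `μ₁` edges. Since its last edge has weight
  -- zero, the change of weight, chords aside, is exactly a difference of heights.
  have hIco : ∀ {i j}, i ≤ j → p j = 0 →
      ∑ k ∈ Ico i j, q k - ∑ k ∈ Ico i (j + 1), p k = h i - h j := by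
    intro i j hij hpj
    rw [sum_Ico_succ_top hij, hpj, add_zero, ← sum_sub_distrib, sum_Ico_eq_sub _ hij]
    simp only [hh, sum_sub_distrib]
    ring
  rcases hf.exists_chords hP hμ₁ hμ₂ hinj hne hn hk hkn with
    ⟨i, j, hij, hadj⟩ | ⟨i₁, i₂, i₃, i₄, h12, h23, h34, ha, hb'⟩
  · have hex := hf.hasExchange_chord hμ₁ hμ₂ hρ hinj hne (hk hij) (hkn j) hadj
    refine ⟨_, image_subset_image fun m hm => ?_, _, ?_, ?_, hex⟩
    · have := hkn j
      rw [mem_Ico] at hm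
      rw [mem_range]
      omega
    all_goals
      have e1 := hIco (hk hij).le (hkp j)
      have e2 := hkanti i j hij.le
      have e3 := hkt i j
      have e4 := hρ' (f (2 * k i)) (f (2 * k j + 1))
      simp only [hp, hq] at e1
      omega
  · have hex := hf.hasExchange_crossing hμ₁ hμ₂ hρ hinj hne (hk h12) (hk h23) (hk h34)
      (hkn i₄) ha hb'
    refine ⟨_, ?_, _, ?_, ?_, hex⟩
    · rw [← image_union]
      refine image_subset_image fun m hm => ?_
      have h4 := hkn i₄
      have h5 := hk h23
      have h6 := hk h34
      simp only [mem_union, mem_Ico] at hm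
      rw [mem_range]
      omega
    all_goals
      have e1 := hIco (hk h12).le (hkp i₂)
      have e1' := hIco (hk h34).le (hkp i₄)
      have e2 := hkanti i₁ i₂ h12.le
      -- The two drops together are at most `h (k i₁) - h (k i₄)`, because the height does not rise
      -- from `k i₂` to `k i₃`.
      have e2' := hkanti i₂ i₃ h23.le
      have e2'' := hkanti i₃ i₄ h34.le
      have e3 := hkt i₁ i₄
      have e4 := hρ' (f (2 * k i₁)) (f (2 * k i₃))
      have e5 := hρ' (f (2 * k i₂ + 1)) (f (2 * k i₄ + 1))
      simp only [hp, hq] at e1 e1'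
      omega

/-- Removing a whole alternating cycle. -/
theorem IsAlternatingSeq.hasExchange_cycle {n : ℕ} (hn : 1 ≤ n)
    (hf : IsAlternatingSeq μ₁ μ₂ f) (hμ₁ : IsMatchingMap G μ₁) (hμ₂ : IsMatchingMap G μ₂)
    (hρ : ∀ v w, ρ v w = ρ w v)
    (hinj : Set.InjOn f (Set.Iio (2 * n))) (hne : ∀ m < 2 * n, μ₂ (f m) ≠ μ₁ (f m))
    (hcyc : f (2 * n) = f 0) :
    HasExchange G μ₁ μ₂ ρ ((range (2 * n)).image f)
      (-∑ k ∈ range n,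
        (ρ (f (2 * k)) (f (2 * k + 1)) - ρ (f (2 * k + 1)) (f (2 * k + 2)))) := by
  -- On a closed sequence the `μ₁` pairs, shifted by one position, cover the same vertices as the
  -- `μ₂` pairs.
  have e : (Ico (2 * 0 + 1) (2 * n + 1)).image f = (Ico (2 * 0) (2 * n)).image f := by
    ext v
    simp only [mem_image, mem_Ico]
    constructor
    · rintro ⟨m, hm, rfl⟩
      rcases eq_or_ne m (2 * n) with rfl | h
      · exact ⟨0, by omega, hcyc.symm⟩
      · exact ⟨m, by omega, rfl⟩
    · rintro ⟨m, hm, rfl⟩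
      rcases eq_or_ne m 0 with rfl | h
      · exact ⟨2 * n, by omega, hcyc⟩
      · exact ⟨m, by omega, rfl⟩
  have hsub : Set.InjOn f (Ico (2 * 0) (2 * n) : Finset ℕ) := by
    refine hinj.mono fun m hm => ?_
    rw [mem_coe, mem_Ico] at hm
    rw [Set.mem_Iio]; omega
  have hsub' : Set.InjOn f (Ico (2 * 0 + 1) (2 * n + 1) : Finset ℕ) := by
    rw [← card_image_iff, e, card_image_of_injOn hsub]
    simp
  obtain ⟨h1, h2, h3⟩ := hf.even_segment hμ₂ hρ (Nat.zero_le n) hsub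
    (fun m hm => hne m (by rw [mem_Ico] at hm; omega))
  have h4 := hf.hasMatchingOn_odd hμ₁ hρ (Nat.zero_le n) hsub'
  rw [e] at h4
  have h5 := h4.hasExchange h1 h2 (by rw [h3]; omega)
  rw [range_eq_Ico, range_eq_Ico, sum_sub_distrib, neg_sub]
  exact h5

end ExactMatching

/-! ### Cutting alternating cycles into blocks -/

namespace ExactMatching

open Finset

variable {V : Type*} {G : SimpleGraph V}

/-- The sequence `x, μ₂ x, μ₁ (μ₂ x), …`. -/
noncomputable def altSeq (μ₁ μ₂ : V → V) (x : V) : ℕ → V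
  | 0 => x
  | m + 1 => if m % 2 = 0 then μ₂ (altSeq μ₁ μ₂ x m) else μ₁ (altSeq μ₁ μ₂ x m)

/-- A list of vertices, together with their partners in `μ₂`, without repetitions, and all of
them on the alternating cycles of `μ₁` and `μ₂`. -/
structure IsOrientedList (μ₁ μ₂ : V → V) (l : List V) : Prop where
  nodup : l.Nodup
  notMem : ∀ x ∈ l, μ₂ x ∉ l
  ne : ∀ x ∈ l, μ₂ x ≠ μ₁ x

/-- The contribution to the weight of the exchange of `μ₁` for `μ₂` made by `x`, `μ₂ x`. -/
def wt (μ₁ μ₂ : V → V) (ρ : V → V → ℤ) (x : V) : ℤ :=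
  ρ x (μ₂ x) - ρ (μ₂ x) (μ₁ (μ₂ x))

/-- The number of edges of weight zero among the two that follow `x` on its alternating cycle. -/
def zeros (μ₁ μ₂ : V → V) (ρ : V → V → ℤ) (x : V) : ℤ :=
  (1 - ρ x (μ₂ x)) + (1 - ρ (μ₂ x) (μ₁ (μ₂ x)))

variable {μ₁ μ₂ : V → V} {ρ : V → V → ℤ}

theorem isAlternatingSeq_altSeq (μ₁ μ₂ : V → V) (x : V) :
    IsAlternatingSeq μ₁ μ₂ (altSeq μ₁ μ₂ x) where
  even k := by simp [altSeq]
  odd k := by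
    conv_rhs => rw [show 2 * k + 2 = (2 * k + 1) + 1 by ring, altSeq]
    rw [if_neg (by omega)]

theorem altSeq_even (μ₁ μ₂ : V → V) (x : V) (k : ℕ) :
    altSeq μ₁ μ₂ x (2 * k) = (fun y => μ₁ (μ₂ y))^[k] x := by
  induction k with
  | zero => rfl
  | succ k ih =>
    have h := isAlternatingSeq_altSeq μ₁ μ₂ x
    rw [Function.iterate_succ_apply', ← ih, h.even, h.odd]
    rfl

theorem IsOrientedList.sublist {l l' : List V} (h : IsOrientedList μ₁ μ₂ l)
    (hl : l'.Sublist l) : IsOrientedList μ₁ μ₂ l' :=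
  ⟨h.nodup.sublist hl, fun x hx hx' => h.notMem x (hl.mem hx) (hl.mem hx'),
    fun x hx => h.ne x (hl.mem hx)⟩

theorem eq_map_iterate_of_isChain {s : V → V} {x : V} {l : List V}
    (h : (x :: l).IsChain fun x y => s x = y) :
    x :: l = (List.range (l.length + 1)).map fun k => s^[k] x := by
  induction l generalizing x with
  | nil => simp
  | cons y l ih =>
    rw [List.isChain_cons_cons] at h
    rw [List.length_cons, ih h.2, List.range_succ_eq_map (n := l.length + 1), List.map_cons,
      List.map_map]
    obtain ⟨rfl, -⟩ := h
    rfl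

theorem sum_map_range (n : ℕ) (g : ℕ → ℤ) :
    ((List.range n).map g).sum = ∑ k ∈ range n, g k := by
  induction n with
  | zero => simp
  | succ n ih => rw [List.range_succ, List.map_append, List.sum_append, ih, sum_range_succ]; simp

variable [DecidableEq V]

/-- The vertices of a list and their partners in `μ₂`. -/
def supp (μ₂ : V → V) (l : List V) : Finset V := l.toFinset ∪ (l.map μ₂).toFinset

/-- The matching `μ₂` can be exchanged on the vertices of the block `l` for one that is closer to
`μ₁` and has a weight larger by at most `W`, but not smaller. -/
def IsGood (G : SimpleGraph V) (μ₁ μ₂ : V → V) (ρ : V → V → ℤ) (W : ℤ) (l : List V) : Prop :=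
  ∃ S ⊆ supp μ₂ l, ∃ δ, 0 ≤ δ ∧ δ ≤ W ∧ HasExchange G μ₁ μ₂ ρ S δ

/-- Translates lists, which are convenient to cut, into sequences, on which the exchanges are made.
An oriented list records every second vertex. -/
theorem IsOrientedList.exists_seq {l : List V} (h : IsOrientedList μ₁ μ₂ l)
    (hμ₁ : IsMatchingMap G μ₁) (hμ₂ : IsMatchingMap G μ₂)
    (hc : l.IsChain fun x y => μ₁ (μ₂ x) = y) (hl : l ≠ []) :
    ∃ f, IsAlternatingSeq μ₁ μ₂ f ∧ Set.InjOn f (Set.Iio (2 * l.length)) ∧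
      (∀ m < 2 * l.length, μ₂ (f m) ≠ μ₁ (f m)) ∧
      supp μ₂ l = (range (2 * l.length)).image f ∧ l.head? = some (f 0) ∧
      (∀ g : V → ℤ, (l.map g).sum = ∑ k ∈ range l.length, g (f (2 * k))) ∧
      f (2 * l.length) = (fun y => μ₁ (μ₂ y))^[l.length] (f 0) := by
  obtain ⟨x, l, rfl⟩ := List.exists_cons_of_ne_nil hl
  have hf := isAlternatingSeq_altSeq μ₁ μ₂ x
  have he : x :: l = (List.range (l.length + 1)).map fun k => altSeq μ₁ μ₂ x (2 * k) := by
    simp only [altSeq_even]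
    exact eq_map_iterate_of_isChain (s := fun y => μ₁ (μ₂ y)) hc
  have hlen : (x :: l).length = l.length + 1 := rfl
  rw [hlen]
  generalize hn : l.length + 1 = n at *
  set f := altSeq μ₁ μ₂ x with hfdef
  have hmem : ∀ k < n, f (2 * k) ∈ x :: l := by
    intro k hk
    rw [he]
    exact List.mem_map.2 ⟨k, List.mem_range.2 hk, rfl⟩
  have hmem' : ∀ v, v ∈ x :: l ↔ ∃ k < n, f (2 * k) = v := by
    intro v
    rw [he]
    simp
  have hinj2 : ∀ i < n, ∀ j < n, f (2 * i) = f (2 * j) → i = j := by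
    intro i hi j hj hij
    have h1 := h.nodup
    rw [he] at h1
    exact List.inj_on_of_nodup_map h1 (List.mem_range.2 hi) (List.mem_range.2 hj) hij
  have hev := hf.even
  refine ⟨f, hf, ?_, ?_, ?_, rfl, fun g => ?_, altSeq_even μ₁ μ₂ x n⟩
  · intro a ha b hb hab
    rw [Set.mem_Iio] at ha hb
    rcases Nat.even_or_odd' a with ⟨i, rfl | rfl⟩ <;> rcases Nat.even_or_odd' b with ⟨j, rfl | rfl⟩
    · rw [hinj2 i (by omega) j (by omega) hab]
    · rw [← hev j] at hab
      exact absurd (hab ▸ hmem i (by omega)) (h.notMem _ (hmem j (by omega)))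
    · rw [← hev i] at hab
      exact absurd (hab ▸ hmem j (by omega)) (h.notMem _ (hmem i (by omega)))
    · rw [← hev i, ← hev j] at hab
      have := congrArg μ₂ hab
      rw [hμ₂.invol, hμ₂.invol] at this
      rw [hinj2 i (by omega) j (by omega) this]
  · intro m hm
    rcases Nat.even_or_odd' m with ⟨k, rfl | rfl⟩
    · exact h.ne _ (hmem k (by omega))
    · rw [← hev k, hμ₂.invol]
      intro h1
      refine h.ne _ (hmem k (by omega)) ?_
      rw [h1, hμ₁.invol, ← h1]
  · ext v
    simp only [supp, mem_union, List.mem_toFinset, List.mem_map, mem_image, mem_range]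
    constructor
    · rintro (hv | ⟨w, hw, rfl⟩)
      · obtain ⟨k, hk, rfl⟩ := (hmem' v).1 hv
        exact ⟨2 * k, by omega, rfl⟩
      · obtain ⟨k, hk, rfl⟩ := (hmem' w).1 hw
        exact ⟨2 * k + 1, by omega, (hev k).symm⟩
    · rintro ⟨m, hm, rfl⟩
      rcases Nat.even_or_odd' m with ⟨k, rfl | rfl⟩
      · exact Or.inl (hmem k (by omega))
      · exact Or.inr ⟨_, hmem k (by omega), hev k⟩
  · rw [he, List.map_map, sum_map_range]
    rfl

theorem IsOrientedList.isGood_path {t : ℕ} (ht : 1 ≤ t) (hP : Pshort G t)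
    (hμ₁ : IsMatchingMap G μ₁) (hμ₂ : IsMatchingMap G μ₂)
    (hρ : ∀ v w, ρ v w = ρ w v) (hρ' : ∀ v w, ρ v w = 0 ∨ ρ v w = 1) {l : List V}
    (h : IsOrientedList μ₁ μ₂ l) (hc : l.IsChain fun x y => μ₁ (μ₂ x) = y)
    (hw : (l.map (wt μ₁ μ₂ ρ)).sum ≤ 0)
    (hb : 4 * (t : ℤ) ^ 2 ≤ (l.map (zeros μ₁ μ₂ ρ)).sum) :
    IsGood G μ₁ μ₂ ρ (4 * t ^ 2) l := by
  have ht' : (1 : ℤ) ≤ t := by exact_mod_cast ht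
  have hl : l ≠ [] := by
    rintro rfl
    simp only [List.map_nil, List.sum_nil] at hb
    nlinarith
  obtain ⟨f, hf, hinj, hne, hs, -, hsum, -⟩ := h.exists_seq hμ₁ hμ₂ hc hl
  rw [hsum] at hw hb
  simp only [wt, zeros, hf.even, hf.odd] at hw hb
  obtain ⟨S, hS, δ, h1, h2, h3⟩ := hf.exists_hasExchange ht hP hμ₁ hμ₂ hρ hρ' hinj hne hw hb
  exact ⟨S, by rwa [hs], δ, h1, by nlinarith, h3⟩

theorem IsOrientedList.isGood_cycle {W : ℤ}
    (hμ₁ : IsMatchingMap G μ₁) (hμ₂ : IsMatchingMap G μ₂)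
    (hρ : ∀ v w, ρ v w = ρ w v) {l : List V} (hl : l ≠ [])
    (h : IsOrientedList μ₁ μ₂ l) (hc : l.IsChain fun x y => μ₁ (μ₂ x) = y)
    (hcyc : ∀ x, l.head? = some x → (fun y => μ₁ (μ₂ y))^[l.length] x = x)
    (hw : (l.map (wt μ₁ μ₂ ρ)).sum ≤ 0) (hb : -W ≤ (l.map (wt μ₁ μ₂ ρ)).sum) :
    IsGood G μ₁ μ₂ ρ W l := by
  obtain ⟨f, hf, hinj, hne, hs, hhead, hsum, hlast⟩ := h.exists_seq hμ₁ hμ₂ hc hl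
  have h1 := hf.hasExchange_cycle (List.length_pos_iff.2 hl) hμ₁ hμ₂ hρ hinj hne
    (by rw [hlast]; exact hcyc _ hhead)
  have h2 := hsum (wt μ₁ μ₂ ρ)
  simp only [wt, hf.even, hf.odd] at h2 hw hb
  exact ⟨_, by rw [hs], _, by omega, by omega, h1⟩

omit [DecidableEq V] in
-- For each vertex the two sides differ by twice the number of weight-zero `μ₁` edges counted there.
theorem neg_zeros_le_wt (hρ' : ∀ v w, ρ v w = 0 ∨ ρ v w = 1) (l : List V) :
    -(l.map (zeros μ₁ μ₂ ρ)).sum ≤ (l.map (wt μ₁ μ₂ ρ)).sum := by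
  induction l with
  | nil => simp
  | cons x l ih =>
    have h1 := hρ' x (μ₂ x)
    have h2 := hρ' (μ₂ x) (μ₁ (μ₂ x))
    simp only [List.map_cons, List.sum_cons, wt, zeros] at ih ⊢
    omega

omit [DecidableEq V] in
/-- A list with elements of small weight can be cut into pieces of about equal weight. -/
theorem exists_flatten_eq {g : V → ℤ} (hg : ∀ x, 0 ≤ g x ∧ g x ≤ 2) {m : ℤ} (hm : 0 < m)
    (l : List V) (hl : m ≤ (l.map g).sum) :
    ∃ L : List (List V), L.flatten = l ∧
      ∀ b ∈ L, m ≤ (b.map g).sum ∧ (b.map g).sum ≤ 2 * m + 2 := by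
  -- Greedy cutting from the right: a block is closed once its sum reaches `m`, and overshoots by at
  -- most 2. The rest `r` at the front is then merged into the first block.
  have key : ∀ l : List V, ∃ r, ∃ L : List (List V), r ++ L.flatten = l ∧ 0 ≤ (r.map g).sum ∧
      (r.map g).sum < m ∧ ∀ b ∈ L, m ≤ (b.map g).sum ∧ (b.map g).sum ≤ m + 2 := by
    intro l
    induction l with
    | nil => exact ⟨[], [], by simp [hm]⟩
    | cons x l ih =>
      obtain ⟨r, L, h1, h2, h3, h4⟩ := ih
      have hx := hg x
      have e : ((x :: r).map g).sum = g x + (r.map g).sum := by simp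
      by_cases h : ((x :: r).map g).sum < m
      · exact ⟨x :: r, L, by simp [h1], by omega, h, h4⟩
      · refine ⟨[], (x :: r) :: L, by simp [h1], by simp, by simpa using hm, ?_⟩
        intro b hb
        rcases List.mem_cons.1 hb with rfl | hb
        · omega
        · exact h4 b hb
  obtain ⟨r, L, h1, h2, h3, h4⟩ := key l
  cases L with
  | nil =>
    simp only [List.flatten_nil, List.append_nil] at h1
    rw [h1] at h3
    omega
  | cons b L =>
    refine ⟨(r ++ b) :: L, by simpa using h1, ?_⟩
    intro b' hb'
    rcases List.mem_cons.1 hb' with rfl | hb'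
    · have := h4 b List.mem_cons_self
      rw [List.map_append, List.sum_append]
      omega
    · have := h4 b' (List.mem_cons_of_mem _ hb')
      omega

/-- A list that runs once around an alternating cycle. -/
structure IsCycleList (μ₁ μ₂ : V → V) (l : List V) : Prop where
  ne_nil : l ≠ []
  chain : l.IsChain fun x y => μ₁ (μ₂ x) = y
  closed : ∀ x, l.head? = some x → (fun y => μ₁ (μ₂ y))^[l.length] x = x

omit [DecidableEq V] in
theorem infix_flatten_of_mem {L : List (List V)} {b : List V} (hb : b ∈ L) :
    b <:+: L.flatten := by
  obtain ⟨s, t, rfl⟩ := List.append_of_mem hb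
  exact ⟨s.flatten, t.flatten, by simp⟩

/-- A cycle with fewer than $4t^2$ zeros stays whole, and swapping it gains less than $4t^2$. A
longer cycle is cut with `m` $= 4t^2$, so that every piece is long enough for the path exchange;
this explains $8t^2+2 = 2m+2$. -/
theorem IsCycleList.exists_blocks {t : ℕ} (ht : 1 ≤ t) (hP : Pshort G t)
    (hμ₁ : IsMatchingMap G μ₁) (hμ₂ : IsMatchingMap G μ₂)
    (hρ : ∀ v w, ρ v w = ρ w v) (hρ' : ∀ v w, ρ v w = 0 ∨ ρ v w = 1) {l : List V}
    (hl : IsCycleList μ₁ μ₂ l) (h : IsOrientedList μ₁ μ₂ l) :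
    ∃ L : List (List V), L.flatten = l ∧ ∀ b ∈ L,
      (b.map (zeros μ₁ μ₂ ρ)).sum ≤ 8 * t ^ 2 + 2 ∧
      (IsGood G μ₁ μ₂ ρ (4 * t ^ 2) b ∨ 1 ≤ (b.map (wt μ₁ μ₂ ρ)).sum) := by
  have ht' : (1 : ℤ) ≤ t := by exact_mod_cast ht
  rcases lt_or_ge (l.map (zeros μ₁ μ₂ ρ)).sum (4 * (t : ℤ) ^ 2) with hlt | hge
  · refine ⟨[l], by simp, fun b hb => ?_⟩
    rw [List.mem_singleton.1 hb]
    refine ⟨by nlinarith, ?_⟩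
    by_cases hw : (l.map (wt μ₁ μ₂ ρ)).sum ≤ 0
    · exact Or.inl (h.isGood_cycle hμ₁ hμ₂ hρ hl.ne_nil hl.chain hl.closed hw
        (by have := neg_zeros_le_wt (μ₁ := μ₁) (μ₂ := μ₂) hρ' l; omega))
    · exact Or.inr (by omega)
  · obtain ⟨L, hL, hLb⟩ := exists_flatten_eq (g := zeros μ₁ μ₂ ρ) (m := 4 * (t : ℤ) ^ 2)
      (fun x => by
        have h1 := hρ' x (μ₂ x)
        have h2 := hρ' (μ₂ x) (μ₁ (μ₂ x))
        simp only [zeros]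
        omega) (by nlinarith) l hge
    refine ⟨L, hL, fun b hb => ?_⟩
    have h1 := hLb b hb
    have h2 : b <:+: l := hL ▸ infix_flatten_of_mem hb
    refine ⟨by omega, ?_⟩
    by_cases hw : (b.map (wt μ₁ μ₂ ρ)).sum ≤ 0
    · exact Or.inl ((h.sublist h2.sublist).isGood_path ht hP hμ₁ hμ₂ hρ hρ'
        (hl.chain.infix h2) hw h1.1)
    · exact Or.inr (by omega)

theorem exists_blocks {t : ℕ} (ht : 1 ≤ t) (hP : Pshort G t)
    (hμ₁ : IsMatchingMap G μ₁) (hμ₂ : IsMatchingMap G μ₂)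
    (hρ : ∀ v w, ρ v w = ρ w v) (hρ' : ∀ v w, ρ v w = 0 ∨ ρ v w = 1) {C : List (List V)}
    (hC : ∀ l ∈ C, IsCycleList μ₁ μ₂ l) (h : IsOrientedList μ₁ μ₂ C.flatten) :
    ∃ L : List (List V), L.flatten = C.flatten ∧ ∀ b ∈ L,
      (b.map (zeros μ₁ μ₂ ρ)).sum ≤ 8 * t ^ 2 + 2 ∧
      (IsGood G μ₁ μ₂ ρ (4 * t ^ 2) b ∨ 1 ≤ (b.map (wt μ₁ μ₂ ρ)).sum) := by
  induction C with
  | nil => exact ⟨[], by simp⟩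
  | cons l C ih =>
    rw [List.flatten_cons] at h
    obtain ⟨L, hL, hLb⟩ := ih (fun l hl => hC l (List.mem_cons_of_mem _ hl))
      (h.sublist (List.sublist_append_right _ _))
    obtain ⟨L', hL', hLb'⟩ := (hC l List.mem_cons_self).exists_blocks ht hP hμ₁ hμ₂ hρ hρ'
      (h.sublist (List.sublist_append_left _ _))
    refine ⟨L' ++ L, by rw [List.flatten_append, hL', hL, List.flatten_cons], fun b hb => ?_⟩
    rcases List.mem_append.1 hb with hb | hb
    · exact hLb' b hb
    · exact hLb b hb

open Classical in
/-- If few blocks allow an exchange, then the total weight is large. -/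
theorem sum_zeros_le {W W' : ℤ} (hW' : 0 ≤ W') (hρ' : ∀ v w, ρ v w = 0 ∨ ρ v w = 1)
    {L : List (List V)}
    (hL : ∀ b ∈ L, (b.map (zeros μ₁ μ₂ ρ)).sum ≤ W' ∧
      (IsGood G μ₁ μ₂ ρ W b ∨ 1 ≤ (b.map (wt μ₁ μ₂ ρ)).sum)) :
    (L.flatten.map (zeros μ₁ μ₂ ρ)).sum ≤
      W' * ((L.flatten.map (wt μ₁ μ₂ ρ)).sum
        + (W' + 1) * (L.countP fun b => IsGood G μ₁ μ₂ ρ W b)) := by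
  induction L with
  | nil => simp
  | cons b L ih =>
    have ih := ih fun b hb => hL b (List.mem_cons_of_mem _ hb)
    obtain ⟨h1, h2⟩ := hL b List.mem_cons_self
    have h3 := neg_zeros_le_wt (μ₁ := μ₁) (μ₂ := μ₂) hρ' b
    rw [List.flatten_cons, List.map_append, List.map_append, List.sum_append, List.sum_append,
      List.countP_cons]
    -- A block that is not good pays for its at most `W'` zeros with weight at least 1. A good one
    -- has weight at least `-W'`, so the extra `W' + 1` again leaves at least 1.
    by_cases hg : IsGood G μ₁ μ₂ ρ W b
    · simp only [hg, decide_true, if_true]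
      push_cast
      nlinarith
    · have h4 := h2.resolve_left hg
      simp only [hg, decide_false, Bool.false_eq_true, if_false]
      push_cast
      nlinarith

end ExactMatching

/-! ### Decomposing the symmetric difference into oriented cycles -/

namespace ExactMatching

open Finset

variable {V : Type*} {G : SimpleGraph V} {μ₁ μ₂ : V → V} {ρ : V → V → ℤ}

/-- Alternating cycles are even, so `μ₂` interchanges the two orientation classes. A coincidence at
distance `d + 2` yields one at distance `d` from the next point; distances 0 and 1 would give a loop
of `G`. -/
theorem IsMatchingMap.apply_ne_iterate (hμ₁ : IsMatchingMap G μ₁) (hμ₂ : IsMatchingMap G μ₂)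
    (d : ℕ) (y : V) : μ₂ y ≠ (fun y => μ₁ (μ₂ y))^[d] y := by
  induction d using Nat.twoStepInduction generalizing y with
  | zero => exact (hμ₂.adj y).ne'
  | one => exact (hμ₁.adj (μ₂ y)).ne
  | more d ih _ =>
    intro h
    rw [Function.iterate_succ_apply'] at h
    have h1 := congrArg (fun v => μ₂ (μ₁ v)) h
    simp only [hμ₁.invol, hμ₂.invol] at h1
    rw [Function.iterate_succ_apply] at h1
    exact ih _ h1

theorem exists_cycleList_of_mem [Finite V] (hμ₁ : IsMatchingMap G μ₁)
    (hμ₂ : IsMatchingMap G μ₂) (x : V) :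
    ∃ l, IsCycleList μ₁ μ₂ l ∧ x ∈ l ∧ l.Nodup ∧ (∀ v ∈ l, μ₂ v ∉ l) ∧
      (∀ v ∈ l, μ₁ (μ₂ v) ∈ l) ∧ (∀ v ∈ l, ∃ k, (fun y => μ₁ (μ₂ y))^[k] x = v) := by
  set s : V → V := fun y => μ₁ (μ₂ y) with hs
  have hsinj : Function.Injective s :=
    (Function.LeftInverse.injective hμ₁.invol).comp (Function.LeftInverse.injective hμ₂.invol)
  have hn : 0 < Function.minimalPeriod s x :=
    Function.minimalPeriod_pos_of_mem_periodicPts (hsinj.mem_periodicPts x)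
  generalize hn' : Function.minimalPeriod s x = n at hn
  have hmem : ∀ v, v ∈ (List.range n).map (fun k => s^[k] x) ↔ ∃ k, s^[k] x = v := by
    intro v
    rw [List.mem_map]
    constructor
    · rintro ⟨k, -, rfl⟩
      exact ⟨k, rfl⟩
    · rintro ⟨k, rfl⟩
      refine ⟨k % n, List.mem_range.2 (Nat.mod_lt _ hn), ?_⟩
      rw [← hn', Function.iterate_mod_minimalPeriod_eq]
  have hper : s^[n] x = x := hn' ▸ Function.iterate_minimalPeriod
  refine ⟨(List.range n).map fun k => s^[k] x, ⟨?_, ?_, ?_⟩, ?_, ?_, ?_, ?_, ?_⟩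
  · simp [hn.ne']
  · rw [List.isChain_iff_getElem]
    intro i hi
    simp only [List.getElem_map, List.getElem_range]
    exact (Function.iterate_succ_apply' s i x).symm
  · intro y hy
    obtain ⟨m, rfl⟩ : ∃ m, n = m + 1 := ⟨n - 1, by omega⟩
    rw [List.range_succ_eq_map] at hy
    simp only [List.map_cons, List.head?_cons, Option.some.injEq] at hy
    subst hy
    rw [List.length_map, List.length_range]
    exact hper
  · exact (hmem x).2 ⟨0, rfl⟩
  · refine List.Nodup.map_on ?_ List.nodup_range
    intro a ha b hb hab
    rw [List.mem_range] at ha hb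
    exact Function.iterate_injOn_Iio_minimalPeriod (f := s) (x := x) (by rwa [hn'])
      (by rwa [hn']) hab
  · intro v hv hv'
    obtain ⟨i, rfl⟩ := (hmem v).1 hv
    obtain ⟨j, hj⟩ := (hmem _).1 hv'
    -- Adding `n * i`, a multiple of the period that is at least `i`, makes it possible to go
    -- backwards by `i` steps.
    have h1 : s^[n * i] x = x := by
      rw [Function.iterate_mul]
      exact Function.iterate_fixed hper i
    have h2 : i ≤ n * i := Nat.le_mul_of_pos_left i hn
    refine hμ₁.apply_ne_iterate hμ₂ (j + (n * i - i)) (s^[i] x) ?_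
    rw [← Function.iterate_add_apply, show j + (n * i - i) + i = j + n * i by omega,
      Function.iterate_add_apply, h1, hj]
  · intro v hv
    obtain ⟨i, rfl⟩ := (hmem v).1 hv
    exact (hmem _).2 ⟨i + 1, Function.iterate_succ_apply' s i x⟩
  · exact fun v hv => (hmem v).1 hv

/-- The vertices of `A` and their partners in `μ₂` are the vertices at which `μ₁` and `μ₂`
differ, and `A` consists of alternating cycles. -/
structure IsTransversal (μ₁ μ₂ : V → V) (A : List V) : Prop where
  oriented : IsOrientedList μ₁ μ₂ A
  cover : ∀ v, μ₂ v ≠ μ₁ v → v ∈ A ∨ μ₂ v ∈ A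
  closed : ∀ v ∈ A, μ₁ (μ₂ v) ∈ A

theorem exists_cycleLists [Finite V] (hμ₁ : IsMatchingMap G μ₁) (hμ₂ : IsMatchingMap G μ₂) :
    ∃ C : List (List V), (∀ l ∈ C, IsCycleList μ₁ μ₂ l) ∧ IsTransversal μ₁ μ₂ C.flatten := by
  classical
  have := Fintype.ofFinite V
  -- Cycles are peeled off one at a time: removing an orbit and its `μ₂` partners leaves a set
  -- closed under both involutions.
  have key : ∀ U : Finset V, (∀ v ∈ U, μ₁ v ∈ U ∧ μ₂ v ∈ U ∧ μ₂ v ≠ μ₁ v) →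
      ∃ C : List (List V), (∀ l ∈ C, IsCycleList μ₁ μ₂ l) ∧ IsOrientedList μ₁ μ₂ C.flatten ∧
        (∀ v ∈ U, v ∈ C.flatten ∨ μ₂ v ∈ C.flatten) ∧
        (∀ v ∈ C.flatten, μ₁ (μ₂ v) ∈ C.flatten) ∧ ∀ v ∈ C.flatten, v ∈ U := by
    intro U
    induction U using Finset.strongInduction with
    | H U ih =>
      intro hU
      rcases U.eq_empty_or_nonempty with rfl | ⟨x, hx⟩
      · exact ⟨[], by simp, ⟨by simp, by simp, by simp⟩, by simp, by simp, by simp⟩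
      obtain ⟨l, hl, hxl, hnd, hnot, hcl, hit⟩ := exists_cycleList_of_mem hμ₁ hμ₂ x
      have hlU : ∀ v ∈ l, v ∈ U := by
        intro v hv
        obtain ⟨k, rfl⟩ := hit v hv
        clear hv
        induction k with
        | zero => exact hx
        | succ k ih =>
          rw [Function.iterate_succ_apply']
          exact (hU _ (hU _ ih).2.1).1
      have hsurj : ∀ v ∈ l, ∃ w ∈ l, μ₁ (μ₂ w) = v := by
        have hinj : Function.Injective fun y => μ₁ (μ₂ y) :=
          (Function.LeftInverse.injective hμ₁.invol).comp
            (Function.LeftInverse.injective hμ₂.invol)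
        have h1 : l.toFinset.image (fun y => μ₁ (μ₂ y)) = l.toFinset := by
          refine eq_of_subset_of_card_le ?_ (card_image_of_injective _ hinj).ge
          intro v hv
          obtain ⟨w, hw, rfl⟩ := mem_image.1 hv
          exact List.mem_toFinset.2 (hcl w (List.mem_toFinset.1 hw))
        intro v hv
        rw [← List.mem_toFinset, ← h1] at hv
        obtain ⟨w, hw, hwv⟩ := mem_image.1 hv
        exact ⟨w, List.mem_toFinset.1 hw, hwv⟩
      have hmem : ∀ v, v ∈ U \ supp μ₂ l ↔ v ∈ U ∧ v ∉ l ∧ μ₂ v ∉ l := by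
        intro v
        simp only [supp, mem_sdiff, mem_union, List.mem_toFinset, List.mem_map, not_or,
          not_exists, not_and]
        refine and_congr_right fun _ => and_congr_right fun _ =>
          ⟨fun h h' => h _ h' (hμ₂.invol v), ?_⟩
        rintro h w hw rfl
        exact h (by rwa [hμ₂.invol])
      have hμ₁l : ∀ v, μ₁ v ∈ l → μ₂ v ∈ l := by
        intro v hv
        obtain ⟨w, hw, hwv⟩ := hsurj _ hv
        have := congrArg μ₁ hwv
        rw [hμ₁.invol, hμ₁.invol] at this
        rwa [← this, hμ₂.invol]
      have hμ₂l : ∀ v, μ₂ (μ₁ v) ∈ l → v ∈ l := by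
        intro v hv
        have := hcl _ hv
        rwa [hμ₂.invol, hμ₁.invol] at this
      obtain ⟨C, hC, hCo, hCc, hCcl, hCU⟩ := ih (U \ supp μ₂ l)
        (by
          refine (ssubset_iff_of_subset sdiff_subset).2 ⟨x, hx, fun h => ?_⟩
          exact ((hmem x).1 h).2.1 hxl)
        (by
          intro v hv
          obtain ⟨h1, h2, h3⟩ := (hmem v).1 hv
          refine ⟨(hmem _).2 ⟨(hU v h1).1, fun h => h3 (hμ₁l v h), fun h => h2 (hμ₂l v h)⟩,
            (hmem _).2 ⟨(hU v h1).2.1, h3, by rwa [hμ₂.invol]⟩, (hU v h1).2.2⟩)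
      refine ⟨l :: C, ?_, ⟨?_, ?_, ?_⟩, ?_, ?_, ?_⟩
      · intro l' hl'
        rcases List.mem_cons.1 hl' with rfl | hl'
        · exact hl
        · exact hC _ hl'
      · rw [List.flatten_cons, List.nodup_append']
        exact ⟨hnd, hCo.nodup, fun v hv hv' => ((hmem v).1 (hCU v hv')).2.1 hv⟩
      · intro v hv hv'
        rw [List.flatten_cons, List.mem_append] at hv hv'
        rcases hv with hv | hv <;> rcases hv' with hv' | hv'
        · exact hnot v hv hv'
        · exact ((hmem _).1 (hCU _ hv')).2.2 (by rwa [hμ₂.invol])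
        · exact ((hmem _).1 (hCU _ hv)).2.2 hv'
        · exact hCo.notMem v hv hv'
      · intro v hv
        rw [List.flatten_cons, List.mem_append] at hv
        rcases hv with hv | hv
        · exact (hU v (hlU v hv)).2.2
        · exact hCo.ne v hv
      · intro v hv
        simp only [List.flatten_cons, List.mem_append]
        by_cases h : v ∈ U \ supp μ₂ l
        · have := hCc v h
          tauto
        · rw [hmem] at h
          tauto
      · intro v hv
        simp only [List.flatten_cons, List.mem_append] at hv ⊢
        exact hv.imp (hcl v) (hCcl v)
      · intro v hv
        simp only [List.flatten_cons, List.mem_append] at hv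
        exact hv.elim (hlU v) fun h => ((hmem v).1 (hCU v h)).1
  obtain ⟨C, h1, h2, h3, h4, -⟩ := key {v | μ₂ v ≠ μ₁ v} (by
    intro v hv
    simp only [mem_filter, mem_univ, true_and] at hv ⊢
    refine ⟨fun h => hv ?_, fun h => hv ?_, hv⟩
    · rw [hμ₁.invol] at h
      have := congrArg μ₂ h
      rw [hμ₂.invol] at this
      exact this.symm
    · rw [hμ₂.invol] at h
      have := congrArg μ₁ h
      rw [hμ₁.invol] at this
      exact this.symm)
  exact ⟨C, h1, h2, fun v hv => h3 v (by simpa using hv), h4⟩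

/-- Vertices outside the cycles cancel. On them, each `μ₂` edge and each `μ₁` edge is met once from
the list and twice in the vertex sums. -/
theorem IsTransversal.two_mul_sum_wt [Fintype V] (hμ₁ : IsMatchingMap G μ₁)
    (hμ₂ : IsMatchingMap G μ₂) (hρ : ∀ v w, ρ v w = ρ w v) {A : List V}
    (hA : IsTransversal μ₁ μ₂ A) :
    2 * (A.map (wt μ₁ μ₂ ρ)).sum = ∑ v, ρ v (μ₂ v) - ∑ v, ρ v (μ₁ v) := by
  classical
  have hinj₂ : Function.Injective μ₂ := Function.LeftInverse.injective hμ₂.invol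
  have hinj : Function.Injective fun y => μ₁ (μ₂ y) :=
    (Function.LeftInverse.injective hμ₁.invol).comp hinj₂
  have hT : A.toFinset.image (fun y => μ₁ (μ₂ y)) = A.toFinset := by
    refine eq_of_subset_of_card_le ?_ (card_image_of_injective _ hinj).ge
    intro v hv
    obtain ⟨w, hw, rfl⟩ := mem_image.1 hv
    exact List.mem_toFinset.2 (hA.closed w (List.mem_toFinset.1 hw))
  have hd : Disjoint A.toFinset (A.toFinset.image μ₂) := by
    rw [disjoint_left]
    intro v hv hv'
    obtain ⟨w, hw, rfl⟩ := mem_image.1 hv'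
    exact hA.oriented.notMem w (List.mem_toFinset.1 hw) (List.mem_toFinset.1 hv)
  have h1 : ∑ v ∈ A.toFinset, ρ v (μ₁ v) = ∑ v ∈ A.toFinset, ρ (μ₂ v) (μ₁ (μ₂ v)) := by
    conv_lhs => rw [← hT]
    rw [sum_image hinj.injOn]
    exact sum_congr rfl fun v _ => by rw [hμ₁.invol, hρ]
  have h2 : ∑ v ∈ A.toFinset ∪ A.toFinset.image μ₂, (ρ v (μ₂ v) - ρ v (μ₁ v))
      = ∑ v, (ρ v (μ₂ v) - ρ v (μ₁ v)) := by
    refine sum_subset (subset_univ _) fun v _ hv => ?_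
    have h : μ₂ v = μ₁ v := by
      by_contra h
      refine hv (mem_union.2 ?_)
      rcases hA.cover v h with h | h
      · exact Or.inl (List.mem_toFinset.2 h)
      · exact Or.inr (mem_image.2 ⟨_, List.mem_toFinset.2 h, hμ₂.invol v⟩)
    rw [h, sub_self]
  rw [← sum_sub_distrib, ← h2, sum_union hd, sum_image hinj₂.injOn,
    ← List.sum_toFinset _ hA.oriented.nodup,
    show A.toFinset.sum (wt μ₁ μ₂ ρ)
      = ∑ v ∈ A.toFinset, (ρ v (μ₂ v) - ρ (μ₂ v) (μ₁ (μ₂ v))) from rfl]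
  simp only [sum_sub_distrib, hμ₂.invol]
  rw [h1, sum_congr rfl fun v _ => hρ (μ₂ v) v]
  ring

/-! ### Selecting disjoint blocks from two different cuttings -/

theorem exists_append_countP {α : Type*} (p : α → Bool) {K : ℕ} {L : List α}
    (hK : K ≤ L.countP p) :
    ∃ L₁ L₂, L = L₁ ++ L₂ ∧ L₁.countP p = K := by
  induction L generalizing K with
  | nil => exact ⟨[], [], rfl, by simpa using hK.antisymm' (Nat.zero_le _)⟩
  | cons a L ih =>
    rcases Nat.eq_zero_or_pos K with rfl | hK0
    · exact ⟨[], a :: L, rfl, rfl⟩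
    rw [List.countP_cons] at hK
    by_cases ha : p a
    · obtain ⟨L₁, L₂, rfl, h⟩ := ih (K := K - 1) (by simp only [ha, if_true] at hK; omega)
      exact ⟨a :: L₁, L₂, rfl, by rw [List.countP_cons, h, if_pos ha]; omega⟩
    · obtain ⟨L₁, L₂, rfl, h⟩ := ih (K := K) (by simpa [ha] using hK)
      exact ⟨a :: L₁, L₂, rfl, by rw [List.countP_cons, h, if_neg ha]; rfl⟩

/-- From two ways to cut a list into blocks one can choose many marked blocks of both kinds such
that all of them are disjoint. -/
theorem exists_disjoint_blocks {α : Type*} (p q : List α → Bool) {K : ℕ}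
    {L M : List (List α)} (h : L.flatten = M.flatten) (hnd : L.flatten.Nodup)
    (hL : 2 * K ≤ L.countP p) (hM : 2 * K + 1 ≤ M.countP q) :
    ∃ L' M' : List (List α), (∀ a ∈ L', a ∈ L ∧ p a) ∧ (∀ b ∈ M', b ∈ M ∧ q b) ∧
      K ≤ L'.length ∧ K ≤ M'.length ∧ (L' ++ M').flatten.Nodup := by
  obtain ⟨L₁, L₂, rfl, hL₁⟩ := exists_append_countP p (K := K) (by omega : K ≤ L.countP p)
  rw [List.countP_append, hL₁] at hL
  -- Cutting after the `K`-th marked block of `L` splits at most one block `c` of `M`; this is the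
  -- reason for the `+ 1` in `hM`. One side has `K` marked blocks of `M`, and the opposite side
  -- supplies those of `L`.
  obtain ⟨M₁, c, M₂, hMe, hM₁, hM₂⟩ : ∃ M₁ c M₂, M = M₁ ++ c ++ M₂ ∧
      M₁.flatten.Sublist L₁.flatten ∧ M₂.flatten.Sublist L₂.flatten ∧ c.length ≤ 1 := by
    rw [List.flatten_append, eq_comm, List.flatten_eq_append_iff] at h
    rcases h with ⟨as, bs, rfl, h1, h2⟩ | ⟨as, bs, c, cs, ds, rfl, h1, h2⟩
    · exact ⟨as, [], bs, by simp, by rw [h1], by rw [h2], by simp⟩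
    · refine ⟨as, [bs ++ c :: cs], ds, by simp, ?_, ?_, by simp⟩
      · rw [h1]; exact List.sublist_append_left _ _
      · rw [h2]; exact List.sublist_append_right _ _
  have hc : c.countP q ≤ 1 := (List.countP_le_length).trans hM₂.2
  have hM₂ := hM₂.1
  subst hMe
  rw [List.countP_append, List.countP_append] at hM
  rw [List.flatten_append] at hnd
  have hfilter : ∀ (r : List α → Bool) (N : List (List α)),
      (N.filter r).flatten.Sublist N.flatten := fun r N => List.filter_sublist.flatten
  by_cases hq : K ≤ M₁.countP q
  · refine ⟨L₂.filter p, M₁.filter q, ?_, ?_, ?_, ?_, ?_⟩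
    · intro a ha; simp only [List.mem_filter] at ha; simp [ha]
    · intro a ha; simp only [List.mem_filter] at ha; simp [ha]
    · rw [← List.countP_eq_length_filter]; omega
    · rwa [← List.countP_eq_length_filter]
    · rw [List.flatten_append, List.nodup_append_comm]
      exact hnd.sublist (((hfilter q M₁).trans hM₁).append (hfilter p L₂))
  · refine ⟨L₁.filter p, M₂.filter q, ?_, ?_, ?_, ?_, ?_⟩
    · intro a ha; simp only [List.mem_filter] at ha; simp [ha]
    · intro a ha; simp only [List.mem_filter] at ha; simp [ha]
    · rw [← List.countP_eq_length_filter]; omega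
    · rw [← List.countP_eq_length_filter]; omega
    · rw [List.flatten_append]
      exact hnd.sublist ((hfilter p L₁).append ((hfilter q M₂).trans hM₂))

end ExactMatching

/-! ### Combining exchanges and using minimality -/

namespace ExactMatching

open Finset

variable {V : Type*} {G : SimpleGraph V} {μ₁ μ₂ : V → V} {ρ : V → V → ℤ}

theorem disjoint_supp [DecidableEq V] (hμ₂ : IsMatchingMap G μ₂) {A b b' : List V}
    (hA : IsOrientedList μ₁ μ₂ A) (hb : b ⊆ A) (hb' : b' ⊆ A) (h : b.Disjoint b') :
    Disjoint (supp μ₂ b) (supp μ₂ b') := by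
  rw [disjoint_left]
  intro v hv hv'
  simp only [supp, mem_union, List.mem_toFinset, List.mem_map] at hv hv'
  rcases hv with hv | ⟨w, hw, rfl⟩ <;> rcases hv' with hv' | ⟨w', hw', he⟩
  · exact h hv hv'
  · exact hA.notMem w' (hb' hw') (hb (he ▸ hv))
  · exact hA.notMem w (hb hw) (hb' hv')
  · have := congrArg μ₂ he
    rw [hμ₂.invol, hμ₂.invol] at this
    exact h hw (this ▸ hw')

/-- Many blocks that allow to increase the weight together with many blocks that allow to
decrease it allow an exchange that keeps the weight. -/
theorem exists_hasExchange_zero [DecidableEq V] (hμ₂ : IsMatchingMap G μ₂) {A : List V}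
    (hA : IsOrientedList μ₁ μ₂ A) {W : ℕ} (hW : 1 ≤ W) {L M : List (List V)}
    (hL : ∀ b ∈ L, b ⊆ A ∧ IsGood G μ₁ μ₂ ρ W b)
    (hM : ∀ b ∈ M, b ⊆ A ∧ IsGood G μ₁ μ₂ (fun v w => 1 - ρ v w) W b)
    (hLc : W * W ≤ L.length) (hMc : W * W ≤ M.length) (hnd : (L ++ M).flatten.Nodup) :
    ∃ S, HasExchange G μ₁ μ₂ ρ S 0 := by
  -- A single exchange with `δ = 0` would already suffice, so all changes may be taken nonzero, as
  -- the zero-sum argument requires.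
  by_contra hno
  have hL' : ∀ b ∈ L, ∃ S ⊆ supp μ₂ b, ∃ δ : ℤ, 1 ≤ δ ∧ δ ≤ W ∧ HasExchange G μ₁ μ₂ ρ S δ := by
    intro b hb
    obtain ⟨S, hS, δ, h1, h2, h3⟩ := (hL b hb).2
    refine ⟨S, hS, δ, ?_, h2, h3⟩
    have : δ ≠ 0 := by
      rintro rfl
      exact hno ⟨S, h3⟩
    omega
  have hM' : ∀ b ∈ M, ∃ S ⊆ supp μ₂ b, ∃ δ : ℤ, -(W : ℤ) ≤ δ ∧ δ ≤ -1 ∧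
      HasExchange G μ₁ μ₂ ρ S δ := by
    intro b hb
    obtain ⟨S, hS, δ, h1, h2, h3⟩ := (hM b hb).2
    refine ⟨S, hS, -δ, by omega, ?_, h3.compl⟩
    have : δ ≠ 0 := by
      rintro rfl
      exact hno ⟨S, by simpa using h3.compl⟩
    omega
  -- Disjoint blocks are distinct only if they are nonempty.
  have hnil : ∀ b ∈ L ++ M, b ≠ [] := by
    rintro b hb rfl
    have key : ∀ {S : Finset V} {δ : ℤ}, S ⊆ supp μ₂ [] → ¬ HasExchange G μ₁ μ₂ ρ S δ := by
      intro S δ hS h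
      obtain ⟨v, hv⟩ := h.nonempty
      simpa [supp] using hS hv
    rcases List.mem_append.1 hb with hb | hb
    · obtain ⟨S, hS, δ, -, -, h⟩ := hL' _ hb
      exact key hS h
    · obtain ⟨S, hS, δ, -, -, h⟩ := hM' _ hb
      exact key hS h
  have hpw := (List.nodup_flatten.1 hnd).2
  have hnd' : (L ++ M).Nodup := by
    refine (List.Pairwise.and_mem.1 hpw).imp ?_
    rintro b b' ⟨hb, -, h⟩ rfl
    obtain ⟨x, hx⟩ := List.exists_mem_of_ne_nil b (hnil b hb)
    exact h hx hx
  obtain ⟨hLn, hMn, hLM⟩ := List.nodup_append'.1 hnd'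
  have hdisj : ∀ b ∈ L ++ M, ∀ b' ∈ L ++ M, b ≠ b' → b.Disjoint b' := by
    intro b hb b' hb' hne
    have : Std.Symm (List.Disjoint (α := V)) := ⟨fun _ _ h => h.symm⟩
    exact hpw.forall hb hb' hne
  have hchoose : ∀ b : List V, ∃ S : Finset V, ∃ δ : ℤ, (b ∈ L ∨ b ∈ M →
      S ⊆ supp μ₂ b ∧ HasExchange G μ₁ μ₂ ρ S δ) ∧ (b ∈ L → 1 ≤ δ ∧ δ ≤ W) ∧
      (b ∈ M → -(W : ℤ) ≤ δ ∧ δ ≤ -1) := by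
    intro b
    by_cases hb : b ∈ L
    · obtain ⟨S, hS, δ, h1, h2, h3⟩ := hL' b hb
      exact ⟨S, δ, fun _ => ⟨hS, h3⟩, fun _ => ⟨h1, h2⟩, fun hb' => absurd hb' (hLM hb)⟩
    · by_cases hb' : b ∈ M
      · obtain ⟨S, hS, δ, h1, h2, h3⟩ := hM' b hb'
        exact ⟨S, δ, fun _ => ⟨hS, h3⟩, fun h => absurd h hb, fun _ => ⟨h1, h2⟩⟩
      · exact ⟨∅, 0, by tauto, by tauto, by tauto⟩
  choose S δ h1 h2 h3 using hchoose
  have hd : Disjoint L.toFinset M.toFinset := by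
    rw [disjoint_left]
    exact fun b hb hb' => hLM (List.mem_toFinset.1 hb) (List.mem_toFinset.1 hb')
  obtain ⟨T, hT, hTne, hT0⟩ := exists_zero_sum (δ := δ) hW hd
    (fun b hb => h2 b (List.mem_toFinset.1 hb)) (fun b hb => h3 b (List.mem_toFinset.1 hb))
    (by rwa [List.toFinset_card_of_nodup hLn]) (by rwa [List.toFinset_card_of_nodup hMn])
  have hTmem : ∀ b ∈ T, b ∈ L ∨ b ∈ M := fun b hb => by
    have := hT hb
    rwa [disjUnion_eq_union, mem_union, List.mem_toFinset, List.mem_toFinset] at this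
  have hsubA : ∀ b ∈ T, b ⊆ A := fun b hb =>
    (hTmem b hb).elim (fun h => (hL b h).1) fun h => (hM b h).1
  refine hno ⟨T.biUnion S, hT0 ▸ HasExchange.biUnion hTne (fun b hb => (h1 b (hTmem b hb)).2) ?_⟩
  intro b hb b' hb' hne
  exact disjoint_of_subset_left (h1 b (hTmem b hb)).1 (disjoint_of_subset_right
    (h1 b' (hTmem b' hb')).1 (disjoint_supp hμ₂ hA (hsubA b hb) (hsubA b' hb')
      (hdisj b (List.mem_append.2 (hTmem b hb)) b' (List.mem_append.2 (hTmem b' hb')) hne)))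

theorem exists_minimal_matching [Fintype V] [DecidableEq V] (P : (V → V) → Prop) (μ₁ : V → V)
    {μ₂ : V → V} (h : P μ₂) :
    ∃ ν, P ν ∧ ∀ ν', P ν' → #{v | ν v ≠ μ₁ v} ≤ #{v | ν' v ≠ μ₁ v} := by
  obtain ⟨ν, hν, hmin⟩ := WellFounded.has_min
    (measure fun ν : V → V => #{v | ν v ≠ μ₁ v}).wf {ν | P ν} ⟨μ₂, h⟩
  exact ⟨ν, hν, fun ν' hν' => not_lt.1 (hmin ν' hν')⟩

theorem sum_zeros_nonneg (hρ' : ∀ v w, ρ v w = 0 ∨ ρ v w = 1) (l : List V) :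
    0 ≤ (l.map (zeros μ₁ μ₂ ρ)).sum := by
  refine List.sum_nonneg fun a ha => ?_
  obtain ⟨x, -, rfl⟩ := List.mem_map.1 ha
  have h1 := hρ' x (μ₂ x)
  have h2 := hρ' (μ₂ x) (μ₁ (μ₂ x))
  simp only [zeros]
  omega

/-- Among matchings of weight at most that of `μ₂`, one closest to `μ₁` is taken. An exchange on a
good block must push it above `μ₂`, by at most $2 \cdot 4t^2$ in the doubled weight, hence still
below `μ₁`. -/
theorem exists_weight_between [Fintype V] {t : ℕ} (ht : 1 ≤ t) (hP : Pshort G t)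
    (hμ₁ : IsMatchingMap G μ₁) (hμ₂ : IsMatchingMap G μ₂)
    (hρ : ∀ v w, ρ v w = ρ w v) (hρ' : ∀ v w, ρ v w = 0 ∨ ρ v w = 1)
    (h : ∑ v, ρ v (μ₂ v) + 8 * (t : ℤ) ^ 2 < ∑ v, ρ v (μ₁ v)) :
    ∃ ν, IsMatchingMap G ν ∧ ∑ v, ρ v (μ₂ v) < ∑ v, ρ v (ν v) ∧
      ∑ v, ρ v (ν v) < ∑ v, ρ v (μ₁ v) := by
  classical
  have ht' : (1 : ℤ) ≤ t := by exact_mod_cast ht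
  obtain ⟨ν, ⟨hν, hle⟩, hmin⟩ := exists_minimal_matching
    (fun ν => IsMatchingMap G ν ∧ ∑ v, ρ v (ν v) ≤ ∑ v, ρ v (μ₂ v)) μ₁ ⟨hμ₂, le_rfl⟩
  obtain ⟨C, hC, hA⟩ := exists_cycleLists hμ₁ hν
  obtain ⟨L, hL, hLb⟩ := exists_blocks ht hP hμ₁ hν hρ hρ' hC hA.oriented
  have h1 := sum_zeros_le (by positivity) hρ' hLb
  have h2 := hA.two_mul_sum_wt hμ₁ hν hρ
  have h3 := sum_zeros_nonneg (μ₁ := μ₁) (μ₂ := ν) hρ' L.flatten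
  rw [← hL] at h2
  have hpos : 0 < L.countP fun b => IsGood G μ₁ ν ρ (4 * t ^ 2) b := by
    by_contra h0
    rw [not_lt, Nat.le_zero] at h0
    rw [h0] at h1
    push_cast at h1
    nlinarith
  obtain ⟨b, -, hb⟩ := List.countP_pos_iff.1 hpos
  obtain ⟨S, -, δ, h4, h5, h6⟩ := of_decide_eq_true hb
  obtain ⟨ν', hν', h7, h8⟩ := h6.exists_isMatchingMap hν
  refine ⟨ν', hν', ?_, by linarith⟩
  by_contra h9
  exact (hmin ν' ⟨hν', not_lt.1 h9⟩).not_gt h8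

/-- The matching is closest to `μ₁` among those with the weight of `μ₂`. If both bounds failed, the
cuttings for `ρ` and for `1 - ρ` would both have many good blocks, and a weight-preserving exchange
would bring it closer. -/
theorem exists_close_matching [Fintype V] {t : ℕ} (ht : 1 ≤ t) (hP : Pshort G t)
    (hμ₁ : IsMatchingMap G μ₁) (hμ₂ : IsMatchingMap G μ₂)
    (hρ : ∀ v w, ρ v w = ρ w v) (hρ' : ∀ v w, ρ v w = 0 ∨ ρ v w = 1)
    (h : |∑ v, ρ v (μ₁ v) - ∑ v, ρ v (μ₂ v)| ≤ 16 * (t : ℤ) ^ 2) :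
    ∃ ν A, IsMatchingMap G ν ∧ ∑ v, ρ v (ν v) = ∑ v, ρ v (μ₂ v) ∧ IsTransversal μ₁ ν A ∧
      ((A.map (zeros μ₁ ν ρ)).sum ≤ 10000 * (t : ℤ) ^ 12 ∨
        (A.map (zeros μ₁ ν fun v w => 1 - ρ v w)).sum ≤ 10000 * (t : ℤ) ^ 12) := by
  classical
  have ht' : (1 : ℤ) ≤ t := by exact_mod_cast ht
  obtain ⟨ν, ⟨hν, hle⟩, hmin⟩ := exists_minimal_matching
    (fun ν => IsMatchingMap G ν ∧ ∑ v, ρ v (ν v) = ∑ v, ρ v (μ₂ v)) μ₁ ⟨hμ₂, rfl⟩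
  obtain ⟨C, hC, hA⟩ := exists_cycleLists hμ₁ hν
  refine ⟨ν, C.flatten, hν, hle, hA, ?_⟩
  by_contra hbig
  rw [not_or, not_le, not_le] at hbig
  set σ : V → V → ℤ := fun v w => 1 - ρ v w with hσdef
  have hσ : ∀ v w, σ v w = σ w v := fun v w => by simp only [hσdef, hρ v w]
  have hσ' : ∀ v w, σ v w = 0 ∨ σ v w = 1 := fun v w => by
    have := hρ' v w
    simp only [hσdef]
    omega
  obtain ⟨L, hL, hLb⟩ := exists_blocks ht hP hμ₁ hν hρ hρ' hC hA.oriented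
  obtain ⟨M, hM, hMb⟩ := exists_blocks ht hP hμ₁ hν hσ hσ' hC hA.oriented
  have h1 := sum_zeros_le (by positivity) hρ' hLb
  have h1' := sum_zeros_le (by positivity) hσ' hMb
  have h2 := hA.two_mul_sum_wt hμ₁ hν hρ
  have h2' := hA.two_mul_sum_wt hμ₁ hν hσ
  simp only [hσdef, sum_sub_distrib] at h2'
  rw [← hσdef] at h2'
  rw [hL] at h1
  rw [hM] at h1'
  rw [abs_le] at h
  set W : ℕ := 4 * t ^ 2 with hW
  have hWz : ((W : ℕ) : ℤ) = 4 * (t : ℤ) ^ 2 := by rw [hW]; push_cast; ring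
  -- With at most $2W^2 = 32t^4$ good blocks, the zeros number at most $10t^2 \cdot 360t^6 =
  -- 3600t^8$, well below the bound.
  have key : ∀ (z w : ℤ) (g : ℕ), 10000 * (t : ℤ) ^ 12 < z → w ≤ 8 * (t : ℤ) ^ 2 →
      z ≤ (8 * (t : ℤ) ^ 2 + 2) * (w + (8 * (t : ℤ) ^ 2 + 2 + 1) * g) →
      2 * (W * W) + 1 ≤ g := by
    intro z w g hz hw hzw
    by_contra hg
    have hg' : (g : ℤ) ≤ 32 * (t : ℤ) ^ 4 := by
      have : (g : ℤ) ≤ 2 * (W * W) := by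
        exact_mod_cast (show g ≤ 2 * (W * W) by omega)
      rw [hWz] at this
      linarith
    have ht2 : (1 : ℤ) ≤ (t : ℤ) ^ 2 := one_le_pow₀ ht'
    have e1 : (8 * (t : ℤ) ^ 2 + 2 + 1) * g ≤ 11 * (t : ℤ) ^ 2 * (32 * (t : ℤ) ^ 4) :=
      mul_le_mul (by linarith) hg' (by positivity) (by positivity)
    have e2 : (t : ℤ) ^ 2 ≤ (t : ℤ) ^ 6 := pow_le_pow_right₀ ht' (by norm_num)
    have e3 : w + (8 * (t : ℤ) ^ 2 + 2 + 1) * g ≤ 360 * (t : ℤ) ^ 6 := by nlinarith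
    have e4 : (8 * (t : ℤ) ^ 2 + 2) * (w + (8 * (t : ℤ) ^ 2 + 2 + 1) * g)
        ≤ (8 * (t : ℤ) ^ 2 + 2) * (360 * (t : ℤ) ^ 6) :=
      mul_le_mul_of_nonneg_left e3 (by positivity)
    have e5 : (8 * (t : ℤ) ^ 2 + 2) * (360 * (t : ℤ) ^ 6)
        ≤ 10 * (t : ℤ) ^ 2 * (360 * (t : ℤ) ^ 6) :=
      mul_le_mul_of_nonneg_right (by linarith) (by positivity)
    have e6 : (t : ℤ) ^ 8 ≤ (t : ℤ) ^ 12 := pow_le_pow_right₀ ht' (by norm_num)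
    have e7 : 10 * (t : ℤ) ^ 2 * (360 * (t : ℤ) ^ 6) = 3600 * (t : ℤ) ^ 8 := by ring
    have e8 : 0 ≤ (t : ℤ) ^ 8 := by positivity
    linarith
  have hg := key _ _ _ hbig.1 (by linarith) h1
  have hg' := key _ _ _ hbig.2 (by linarith) h1'
  obtain ⟨L', M', hL', hM', hLc, hMc, hnd⟩ := exists_disjoint_blocks _ _ (K := W * W)
    (hL.trans hM.symm) (hL ▸ hA.oriented.nodup) (Nat.le_of_succ_le hg) hg'
  obtain ⟨S, hS⟩ := exists_hasExchange_zero hν hA.oriented (ρ := ρ) (W := W)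
    (by rw [hW]; have := Nat.one_le_pow 2 t ht; omega) (L := L') (M := M')
    (fun b hb => ⟨hL ▸ (infix_flatten_of_mem (hL' b hb).1).subset,
      hWz ▸ of_decide_eq_true (hL' b hb).2⟩)
    (fun b hb => ⟨hM ▸ (infix_flatten_of_mem (hM' b hb).1).subset,
      hWz ▸ of_decide_eq_true (hM' b hb).2⟩) hLc hMc hnd
  obtain ⟨ν', hν', h7, h8⟩ := hS.exists_isMatchingMap hν
  exact (hmin ν' ⟨hν', by linarith⟩).not_gt h8

/-! ### Back to subgraphs and colour counts -/

open Classical in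
/-- The indicator of the edges of colour `col`. -/
noncomputable def colorInd (c : G.edgeSet → EdgeColor) (col : EdgeColor) (v w : V) : ℤ :=
  if ∃ h : s(v, w) ∈ G.edgeSet, c ⟨s(v, w), h⟩ = col then 1 else 0

theorem colorInd_comm (c : G.edgeSet → EdgeColor) (col : EdgeColor) (v w : V) :
    colorInd c col v w = colorInd c col w v := by
  unfold colorInd
  rw [Sym2.eq_swap]

theorem colorInd_eq (c : G.edgeSet → EdgeColor) (col : EdgeColor) (v w : V) :
    colorInd c col v w = 0 ∨ colorInd c col v w = 1 := by
  unfold colorInd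
  split_ifs <;> simp

theorem two_mul_redCount [Fintype V] (c : G.edgeSet → EdgeColor) {M : G.Subgraph} {μ : V → V}
    (hμ : IsMatchingMap G μ) (hM : ∀ v w, M.Adj v w ↔ μ v = w) :
    2 * (redCount c M : ℤ) = ∑ v, colorInd c EdgeColor.red v (μ v) := by
  classical
  let φ : V → G.edgeSet := fun v => ⟨s(v, μ v), hμ.adj v⟩
  set E : Finset G.edgeSet := {e | (e : Sym2 V) ∈ M.edgeSet ∧ c e = EdgeColor.red} with hE
  have h1 : redCount c M = #E := by
    rw [redCount, colorCount, ← Set.ncard_coe_finset, hE]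
    congr 1
    ext e
    simp
  have h2 : ∑ v, colorInd c EdgeColor.red v (μ v)
      = #{v | c (φ v) = EdgeColor.red} := by
    rw [card_filter]
    push_cast
    refine sum_congr rfl fun v _ => ?_
    unfold colorInd
    have : (∃ h : s(v, μ v) ∈ G.edgeSet, c ⟨s(v, μ v), h⟩ = EdgeColor.red)
        ↔ c (φ v) = EdgeColor.red := ⟨fun ⟨_, h⟩ => h, fun h => ⟨_, h⟩⟩
    simp only [this]
  have hmaps : ((({v | c (φ v) = EdgeColor.red} : Finset V) : Set V)).MapsTo φ E := by
    intro v hv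
    have hv : c (φ v) = EdgeColor.red := by simpa using hv
    rw [mem_coe, hE, mem_filter]
    exact ⟨mem_univ _, (hM v (μ v)).2 rfl, hv⟩
  -- Each red matching edge is reached from exactly its two ends.
  have h3 : ∀ e ∈ E, #{v ∈ ({v | c (φ v) = EdgeColor.red} : Finset V) | φ v = e} = 2 := by
    rintro ⟨e, he⟩ heE
    rw [hE, mem_filter] at heE
    obtain ⟨-, heM, hec⟩ := heE
    induction e using Sym2.ind with
    | _ v w =>
      obtain rfl := (hM v w).1 heM
      rw [← card_pair (hμ.adj v).ne]
      congr 1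
      ext u
      simp only [mem_filter, mem_univ, true_and, mem_insert, mem_singleton, φ, Subtype.ext_iff,
        Sym2.eq_iff]
      constructor
      · rintro ⟨-, h | h⟩
        · exact Or.inl h.1
        · exact Or.inr h.1
      · rintro (rfl | rfl)
        · exact ⟨hec, Or.inl ⟨rfl, rfl⟩⟩
        · refine ⟨?_, Or.inr ⟨rfl, hμ.invol v⟩⟩
          rw [← hec]
          congr 2
          rw [hμ.invol, Sym2.eq_swap]
  rw [h1, h2, card_eq_sum_card_fiberwise hmaps, sum_congr rfl h3, sum_const]
  simp [mul_comm]

/-- Every edge of the symmetric difference is one of the two that follow some vertex of `A`, and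
those of colour `col` have weight zero. -/
theorem colorCount_symmDiff_le [Finite V] (c : G.edgeSet → EdgeColor) (col : EdgeColor)
    (hμ₁ : IsMatchingMap G μ₁) (hμ₂ : IsMatchingMap G μ₂) {M₁ M₂ : G.Subgraph}
    (hM₁ : ∀ v w, M₁.Adj v w ↔ μ₁ v = w) (hM₂ : ∀ v w, M₂.Adj v w ↔ μ₂ v = w)
    (hρ' : ∀ v w, ρ v w = 0 ∨ ρ v w = 1)
    (hcol : ∀ v w (h : s(v, w) ∈ G.edgeSet), c ⟨s(v, w), h⟩ = col → ρ v w = 0)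
    {A : List V} (hA : IsTransversal μ₁ μ₂ A) :
    (colorCount c col (symmDiff M₁.edgeSet M₂.edgeSet) : ℤ)
      ≤ (A.map (zeros μ₁ μ₂ ρ)).sum := by
  classical
  let e₁ : V → G.edgeSet := fun v => ⟨s(v, μ₂ v), hμ₂.adj v⟩
  let e₂ : V → G.edgeSet := fun v => ⟨s(μ₂ v, μ₁ (μ₂ v)), hμ₁.adj (μ₂ v)⟩
  set T := A.toFinset with hT
  have hmemA : ∀ v, μ₂ v ≠ μ₁ v → v ∈ T ∨ μ₂ v ∈ T := fun v hv => by
    simpa [hT] using hA.cover v hv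
  have hsurj : ∀ v ∈ T, ∃ w ∈ T, μ₁ (μ₂ w) = v := by
    have hinj : Function.Injective fun y => μ₁ (μ₂ y) :=
      (Function.LeftInverse.injective hμ₁.invol).comp (Function.LeftInverse.injective hμ₂.invol)
    have h1 : T.image (fun y => μ₁ (μ₂ y)) = T := by
      refine eq_of_subset_of_card_le ?_ (card_image_of_injective _ hinj).ge
      intro v hv
      obtain ⟨w, hw, rfl⟩ := mem_image.1 hv
      exact List.mem_toFinset.2 (hA.closed w (List.mem_toFinset.1 hw))
    intro v hv
    rw [← h1] at hv
    exact mem_image.1 hv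
  have hsub : {e : G.edgeSet | (e : Sym2 V) ∈ symmDiff M₁.edgeSet M₂.edgeSet ∧ c e = col} ⊆
      (({v ∈ T | ρ v (μ₂ v) = 0}.image e₁ ∪
        {v ∈ T | ρ (μ₂ v) (μ₁ (μ₂ v)) = 0}.image e₂ : Finset G.edgeSet) : Set G.edgeSet) := by
    rintro ⟨e, he⟩ ⟨hd, hc⟩
    have key : ∀ x y : V, s(x, y) = e → ρ x y = 0 := by
      rintro x y rfl
      exact hcol x y he hc
    simp only [coe_union, coe_image, Set.mem_union, Set.mem_image, mem_coe, mem_filter, e₁, e₂,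
      Subtype.ext_iff]
    have fin₁ : ∀ x ∈ T, s(x, μ₂ x) = e →
        ∃ x, (x ∈ T ∧ ρ x (μ₂ x) = 0) ∧ s(x, μ₂ x) = e :=
      fun x hx h => ⟨x, ⟨hx, key _ _ h⟩, h⟩
    have fin₂ : ∀ x ∈ T, s(μ₂ x, μ₁ (μ₂ x)) = e →
        ∃ x, (x ∈ T ∧ ρ (μ₂ x) (μ₁ (μ₂ x)) = 0) ∧ s(μ₂ x, μ₁ (μ₂ x)) = e :=
      fun x hx h => ⟨x, ⟨hx, key _ _ h⟩, h⟩
    induction e using Sym2.ind with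
    | _ v w =>
      rw [Set.mem_symmDiff, SimpleGraph.Subgraph.mem_edgeSet, SimpleGraph.Subgraph.mem_edgeSet,
        hM₁, hM₂] at hd
      rcases hd with ⟨rfl, h⟩ | ⟨rfl, h⟩
      · right
        rcases hmemA v h with hv | hv
        · obtain ⟨x, hx, rfl⟩ := hsurj v hv
          exact fin₂ x hx (by rw [hμ₁.invol, Sym2.eq_swap])
        · exact fin₂ _ hv (by rw [hμ₂.invol])
      · left
        rcases hmemA v (Ne.symm h) with hv | hv
        · exact fin₁ v hv rfl
        · exact fin₁ _ hv (by rw [hμ₂.invol, Sym2.eq_swap])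
  have hcount : ∀ g : V → ℤ, (∀ v, g v = 0 ∨ g v = 1) →
      (#{v ∈ T | g v = 0} : ℤ) = ∑ v ∈ T, (1 - g v) := by
    intro g hg
    rw [card_filter]
    push_cast
    refine sum_congr rfl fun v _ => ?_
    rcases hg v with h | h <;> simp [h]
  have h1 : colorCount c col (symmDiff M₁.edgeSet M₂.edgeSet)
      ≤ #{v ∈ T | ρ v (μ₂ v) = 0} + #{v ∈ T | ρ (μ₂ v) (μ₁ (μ₂ v)) = 0} := by
    refine (Set.ncard_le_ncard hsub (finite_toSet _)).trans ?_
    rw [Set.ncard_coe_finset]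
    exact (card_union_le _ _).trans (add_le_add card_image_le card_image_le)
  rw [← List.sum_toFinset _ hA.oriented.nodup, ← hT]
  have h2 : ∑ v ∈ T, zeros μ₁ μ₂ ρ v
      = #{v ∈ T | ρ v (μ₂ v) = 0} + #{v ∈ T | ρ (μ₂ v) (μ₁ (μ₂ v)) = 0} := by
    rw [hcount _ fun v => hρ' _ _, hcount _ fun v => hρ' _ _, ← sum_add_distrib]
    rfl
  rw [h2]
  exact_mod_cast h1

theorem exists_redCount_between [Finite V] {t : ℕ} (ht : 1 ≤ t) (hP : Pshort G t)
    (c : G.edgeSet → EdgeColor) {M₁ M₂ : G.Subgraph} (hM₁ : M₁.IsPerfectMatching)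
    (hM₂ : M₂.IsPerfectMatching)
    (h : (redCount c M₂ : ℤ) + 8 * (t : ℤ) ^ 2 < redCount c M₁) :
    ∃ M : G.Subgraph, M.IsPerfectMatching ∧ redCount c M₂ < redCount c M ∧
      redCount c M < redCount c M₁ := by
  have := Fintype.ofFinite V
  obtain ⟨μ₁, hμ₁, hMμ₁⟩ := exists_isMatchingMap_of_isPerfectMatching hM₁
  obtain ⟨μ₂, hμ₂, hMμ₂⟩ := exists_isMatchingMap_of_isPerfectMatching hM₂
  have h1 := two_mul_redCount c hμ₁ hMμ₁
  have h2 := two_mul_redCount c hμ₂ hMμ₂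
  obtain ⟨ν, hν, h3, h4⟩ := exists_weight_between ht hP hμ₁ hμ₂ (colorInd_comm c EdgeColor.red)
    (colorInd_eq c _) (by rw [← h1, ← h2]; nlinarith)
  obtain ⟨M, hM, hMν⟩ := hν.exists_subgraph
  have h5 := two_mul_redCount c hν hMν
  exact ⟨M, hM, by omega, by omega⟩

theorem exists_pmDist_le [Finite V] {t : ℕ} (ht : 1 ≤ t) (hP : Pshort G t)
    (c : G.edgeSet → EdgeColor) {M₁ M₂ : G.Subgraph} (hM₁ : M₁.IsPerfectMatching)
    (hM₂ : M₂.IsPerfectMatching)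
    (h : |(redCount c M₁ : ℤ) - redCount c M₂| ≤ 8 * (t : ℤ) ^ 2) :
    ∃ M : G.Subgraph, M.IsPerfectMatching ∧ redCount c M = redCount c M₂ ∧
      pmDist c M₁ M ≤ 10000 * t ^ 12 := by
  have := Fintype.ofFinite V
  obtain ⟨μ₁, hμ₁, hMμ₁⟩ := exists_isMatchingMap_of_isPerfectMatching hM₁
  obtain ⟨μ₂, hμ₂, hMμ₂⟩ := exists_isMatchingMap_of_isPerfectMatching hM₂
  have h1 := two_mul_redCount c hμ₁ hMμ₁
  have h2 := two_mul_redCount c hμ₂ hMμ₂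
  have hρ' := colorInd_eq c EdgeColor.red
  obtain ⟨ν, A, hν, h3, hA, h4⟩ := exists_close_matching ht hP hμ₁ hμ₂
    (colorInd_comm c EdgeColor.red) hρ' (by rw [← h1, ← h2]; rw [abs_le] at h ⊢; omega)
  obtain ⟨M, hM, hMν⟩ := hν.exists_subgraph
  have h5 := two_mul_redCount c hν hMν
  refine ⟨M, hM, by omega, ?_⟩
  rcases h4 with h4 | h4
  · refine (min_le_right _ _).trans ?_
    have h6 := colorCount_symmDiff_le c EdgeColor.blue hμ₁ hν hMμ₁ hMν hρ' (fun v w he hc => by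
      rw [colorInd, if_neg]
      rintro ⟨_, hr⟩
      rw [hc] at hr
      cases hr) hA
    exact_mod_cast h6.trans h4
  · refine (min_le_left _ _).trans ?_
    have h6 := colorCount_symmDiff_le c EdgeColor.red hμ₁ hν hMμ₁ hMν
      (ρ := fun v w => 1 - colorInd c EdgeColor.red v w)
      (fun v w => by have := hρ' v w; omega) (fun v w he hc => by
        rw [colorInd, if_pos ⟨he, hc⟩]; rfl) hA
    exact_mod_cast h6.trans h4

end ExactMatching

theorem mainTheorem2 :
    ∃ C : ℕ, ∀ (V : Type*) [Finite V] (G : SimpleGraph V) (t : ℕ), 2 ≤ t →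
      ExactMatching.Pshort G t →
      ∀ (c : G.edgeSet → ExactMatching.EdgeColor) (M₁ M₂ : G.Subgraph),
        M₁.IsPerfectMatching → M₂.IsPerfectMatching →
        (8 * (t : ℤ) ^ 2 <
            |(ExactMatching.redCount c M₁ : ℤ) - (ExactMatching.redCount c M₂ : ℤ)| →
          ∃ M : G.Subgraph, M.IsPerfectMatching ∧
            min (ExactMatching.redCount c M₁) (ExactMatching.redCount c M₂)
              < ExactMatching.redCount c M ∧
            ExactMatching.redCount c M
              < max (ExactMatching.redCount c M₁) (ExactMatching.redCount c M₂)) ∧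
        (|(ExactMatching.redCount c M₁ : ℤ) - (ExactMatching.redCount c M₂ : ℤ)|
            ≤ 8 * (t : ℤ) ^ 2 →
          ∃ M₂' : G.Subgraph, M₂'.IsPerfectMatching ∧
            ExactMatching.redCount c M₂' = ExactMatching.redCount c M₂ ∧
            ExactMatching.pmDist c M₁ M₂' ≤ C * t ^ 12) := by
  refine ⟨10000, fun V _ G t ht hP c M₁ M₂ hM₁ hM₂ => ⟨fun h => ?_, fun h => ?_⟩⟩
  · rcases lt_abs.1 h with h | h
    · obtain ⟨M, hM, h1, h2⟩ :=
        ExactMatching.exists_redCount_between (by omega) hP c hM₁ hM₂ (by linarith)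
      exact ⟨M, hM, by omega, by omega⟩
    · obtain ⟨M, hM, h1, h2⟩ :=
        ExactMatching.exists_redCount_between (by omega) hP c hM₂ hM₁ (by linarith)
      exact ⟨M, hM, by omega, by omega⟩
  · exact ExactMatching.exists_pmDist_le (by omega) hP c hM₁ hM₂ h
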